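/- Let $m\ge 0$ be an integer. Let $\mathcal P(^m c_0)$ be the space of continuous $m$-homogeneous polynomials $P(x)=A(x,\dots,x)$ ($A$ a continuous $m$-linear form) on the complex space $c_0$, normed by $\|P\|=\sup_{\|x\|_\infty\le 1}|P(x)|$. For $P\in\mathcal P(^m c_0)$ let $A$ be the associated symmetric $m$-linear form, and let $\tilde A$ be its Arens extension to $c_0^{**}=\ell_\infty$, that is, the $m$-linear form $\tilde A(z_1,\dots,z_m)=z_1\big(x_1\mapsto z_2(x_2\mapsto\cdots z_m(x_m\mapsto A(x_1,\dots,x_m))\cdots)\big)$, which extends $A$ and is weak$^*$-continuous in $z_j$ whenever the first $j-1$ variables lie in $c_0$. Here $z\in\ell_\infty$ acts on $\varphi\in c_0^*$ by $z(\varphi)=\sum_n z_n\varphi(e_n)$. Let $AB(P)(z)=\tilde A(z,\dots,z)$, $z\in\ell_\infty$, be the Aron–Berner extension of $P$. Let $\mathbb T^\infty=\mathbb T^{\mathbb N}\subset\ell_\infty$ carry the product $\mu$ of the normalized Lebesgue measures on the circle $\mathbb T$; for $f\in L_\infty(\mathbb T^\infty)$ and a finitely supported $\alpha\in\mathbb Z^{(\mathbb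 N)}$ let $\hat f(\alpha)=\int_{\mathbb T^\infty} f(w)\,w^{-\alpha}\,d\mu(w)$. Let $H_\infty^m(\mathbb T^\infty)$ be the subspace, with the norm of $L_\infty(\mathbb T^\infty)$, of those $f\in L_\infty(\mathbb T^\infty)$ such that $\hat f(\alpha)\neq 0$ only if all $\alpha_n\ge 0$ and $|\alpha|=\sum_n\alpha_n=m$. Then the mapping $\psi:\mathcal P(^m c_0)\to H_\infty^m(\mathbb T^\infty)$ given by $\psi(P)(w)=AB(P)(w)$ for ($\mu$-almost every) $w\in\mathbb T^\infty$ is a well-defined, linear, surjective isometry. -/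

import Mathlib

open MeasureTheory Filter Topology
open scoped ENNReal ZeroAtInfty

noncomputable section

namespace AronBerner

/-! ### Homogeneous polynomials on a complex normed space -/

section Polynomials

variable (m : ℕ) (X : Type*) [NormedAddCommGroup X] [NormedSpace ℂ X]

/-- Continuous `m`-linear forms on `X`. -/
abbrev Form : Type _ := ContinuousMultilinearMap ℂ (fun _ : Fin m => X) ℂ

/-- The functions `P : X → ℂ` of the form `P x = A (x, …, x)`, with `A` a continuous
`m`-linear form. -/
def homPolySubmodule : Submodule ℂ (X → ℂ) where
  carrier := {P | ∃ A : Form m X, ∀ x, P x = A fun _ => x}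
  zero_mem' := ⟨0, fun _ => rfl⟩
  add_mem' := by
    rintro P Q ⟨A, hA⟩ ⟨B, hB⟩
    exact ⟨A + B, fun x => by simp [hA, hB]⟩
  smul_mem' := by
    rintro c P ⟨A, hA⟩
    exact ⟨c • A, fun x => by simp [hA]⟩

/-- The space `𝒫(ᵐX)` of continuous `m`-homogeneous polynomials on `X`. -/
def HomPoly : Type _ := homPolySubmodule m X

instance : AddCommGroup (HomPoly m X) := inferInstanceAs (AddCommGroup (homPolySubmodule m X))

instance : Module ℂ (HomPoly m X) := inferInstanceAs (Module ℂ (homPolySubmodule m X))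

variable {m X}

instance : CoeFun (HomPoly m X) (fun _ => X → ℂ) := ⟨fun P => P.1⟩

@[ext] theorem HomPoly.ext {P Q : HomPoly m X} (h : ∀ x, P x = Q x) : P = Q :=
  Subtype.ext (funext h)

theorem HomPoly.exists_form (P : HomPoly m X) : ∃ A : Form m X, ∀ x, P x = A fun _ => x := P.2

@[simp] theorem HomPoly.zero_apply (x : X) : (0 : HomPoly m X) x = 0 := rfl

@[simp] theorem HomPoly.add_apply (P Q : HomPoly m X) (x : X) : (P + Q) x = P x + Q x := rfl

@[simp] theorem HomPoly.smul_apply (c : ℂ) (P : HomPoly m X) (x : X) : (c • P) x = c * P x := rfl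

theorem HomPoly.map_smul (P : HomPoly m X) (c : ℂ) (x : X) : P (c • x) = c ^ m * P x := by
  obtain ⟨A, hA⟩ := P.exists_form
  rw [hA, hA]
  simpa using A.map_smul_univ (fun _ => c) (fun _ => x)

/-- The norm of a polynomial: its supremum on the closed unit ball. -/
instance : Norm (HomPoly m X) := ⟨fun P => ⨆ x : Metric.closedBall (0 : X) 1, ‖P x‖⟩

theorem HomPoly.norm_def (P : HomPoly m X) :
    ‖P‖ = ⨆ x : Metric.closedBall (0 : X) 1, ‖P x‖ := rfl

theorem HomPoly.bddAbove (P : HomPoly m X) :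
    BddAbove (Set.range fun x : Metric.closedBall (0 : X) 1 => ‖P x‖) := by
  obtain ⟨A, hA⟩ := P.exists_form
  refine ⟨‖A‖, ?_⟩
  rintro _ ⟨⟨x, hx⟩, rfl⟩
  have hx1 : ‖x‖ ≤ 1 := by simpa using hx
  calc ‖P x‖ = ‖A fun _ => x‖ := by rw [hA]
    _ ≤ ‖A‖ * ∏ _i : Fin m, ‖x‖ := A.le_opNorm _
    _ ≤ ‖A‖ * 1 := by
      gcongr
      simpa using pow_le_one₀ (norm_nonneg x) hx1
    _ = ‖A‖ := mul_one _

theorem HomPoly.norm_apply_le (P : HomPoly m X) {x : X} (hx : ‖x‖ ≤ 1) : ‖P x‖ ≤ ‖P‖ :=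
  le_ciSup P.bddAbove ⟨x, by simpa using hx⟩

theorem HomPoly.norm_le {P : HomPoly m X} {C : ℝ} (h : ∀ x : X, ‖x‖ ≤ 1 → ‖P x‖ ≤ C) :
    ‖P‖ ≤ C := by
  have : Nonempty (Metric.closedBall (0 : X) 1) := ⟨⟨0, by simp⟩⟩
  exact ciSup_le fun x => h x (mem_closedBall_zero_iff.1 x.2)

theorem HomPoly.normCore : NormedSpace.Core ℂ (HomPoly m X) where
  norm_nonneg P := (norm_nonneg _).trans (P.norm_apply_le (x := 0) (by simp))
  norm_smul c P := by
    rw [HomPoly.norm_def, HomPoly.norm_def, Real.mul_iSup_of_nonneg (norm_nonneg c)]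
    simp
  norm_triangle P Q := HomPoly.norm_le fun x hx =>
    (norm_add_le _ _).trans (add_le_add (P.norm_apply_le hx) (Q.norm_apply_le hx))
  norm_eq_zero_iff P := by
    constructor
    · intro h
      ext x
      have hpos : (0 : ℝ) < ‖x‖ + 1 := by positivity
      have hne : ((‖x‖ + 1 : ℝ) : ℂ) ≠ 0 := by exact_mod_cast hpos.ne'
      have hball : ‖(((‖x‖ + 1 : ℝ) : ℂ)⁻¹) • x‖ ≤ 1 := by
        rw [norm_smul, norm_inv, Complex.norm_real, Real.norm_of_nonneg hpos.le,
          inv_mul_le_iff₀ hpos]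
        linarith
      have h0 := P.norm_apply_le hball
      rw [h] at h0
      have h1 := norm_le_zero_iff.1 h0
      have h2 := P.map_smul ((‖x‖ + 1 : ℝ) : ℂ) ((((‖x‖ + 1 : ℝ) : ℂ)⁻¹) • x)
      rw [smul_inv_smul₀ hne, h1, mul_zero] at h2
      exact h2
    · rintro rfl
      simp [HomPoly.norm_def]

instance : NormedAddCommGroup (HomPoly m X) := NormedAddCommGroup.ofCore HomPoly.normCore

instance : NormedSpace ℂ (HomPoly m X) := NormedSpace.ofCore HomPoly.normCore

/-- Symmetry of an `m`-linear form. -/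
def IsSymm (A : Form m X) : Prop :=
  ∀ (σ : Equiv.Perm (Fin m)) (v : Fin m → X), A (fun i => v (σ i)) = A v

theorem HomPoly.exists_symm_form (P : HomPoly m X) :
    ∃ A : Form m X, IsSymm A ∧ ∀ x, P x = A fun _ => x := by
  obtain ⟨A, hA⟩ := P.exists_form
  refine ⟨((m.factorial : ℂ)⁻¹) • ∑ σ : Equiv.Perm (Fin m), A.domDomCongr σ, ?_, ?_⟩
  · intro τ v
    simp only [_root_.smul_apply, sum_apply,
      ContinuousMultilinearMap.domDomCongr_apply]
    congr 1
    exact Fintype.sum_equiv (Equiv.mulLeft τ) _ _ fun σ => rfl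
  · intro x
    simp only [_root_.smul_apply, sum_apply,
      ContinuousMultilinearMap.domDomCongr_apply, Finset.sum_const, Finset.card_univ,
      Fintype.card_perm, Fintype.card_fin, nsmul_eq_mul, smul_eq_mul, hA]
    rw [inv_mul_cancel_left₀ (by exact_mod_cast m.factorial_ne_zero)]

/-- A symmetric form is determined by its values on the diagonal. -/
theorem IsSymm.ext_diag {A B : Form m X} (hA : IsSymm A) (hB : IsSymm B)
    (h : ∀ x, (A fun _ => x) = B fun _ => x) : A = B := by
  ext v
  have h1 := A.iteratedFDeriv_comp_diagonal 0 v
  have h2 := B.iteratedFDeriv_comp_diagonal 0 v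
  have h3 : (fun x : X => A fun _ => x) = fun x => B fun _ => x := funext h
  rw [h3, h2] at h1
  simp only [hA _ v, hB _ v, Finset.sum_const, Finset.card_univ, Fintype.card_perm,
    Fintype.card_fin, nsmul_eq_mul] at h1
  exact (mul_left_cancel₀ (by exact_mod_cast m.factorial_ne_zero) h1).symm

/-- The symmetric `m`-linear form associated with a polynomial (unique by `IsSymm.ext_diag`). -/
def HomPoly.symmForm (P : HomPoly m X) : Form m X := P.exists_symm_form.choose

theorem HomPoly.symmForm_isSymm (P : HomPoly m X) : IsSymm P.symmForm :=
  P.exists_symm_form.choose_spec.1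

theorem HomPoly.symmForm_diag (P : HomPoly m X) (x : X) : P x = P.symmForm fun _ => x :=
  P.exists_symm_form.choose_spec.2 x

end Polynomials

/-! ### The Arens and Aron–Berner extensions -/

section Extension

variable (X : Type*) [NormedAddCommGroup X] [NormedSpace ℂ X]

/-- The bidual of `X`. -/
abbrev Bidual : Type _ := StrongDual ℂ (StrongDual ℂ X)

set_option maxSynthPendingDepth 4 in
/-- One step of the Arens extension: a bounded operator `B` from `X` to the `m`-linear forms on
`X**` is extended to `X**` by `(z, z₁, …, zₘ) ↦ z (x ↦ B x (z₁, …, zₘ))`. -/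
def arensStep (m : ℕ) : (X →L[ℂ] Form m (Bidual X)) →L[ℂ] (Bidual X →L[ℂ] Form m (Bidual X)) :=
  (ContinuousLinearMap.compContinuousMultilinearMapL ℂ (fun _ : Fin m => Bidual X)
      (StrongDual ℂ X) ℂ).flip ∘L
    (ContinuousLinearMap.flipMultilinearEquiv ℂ (fun _ : Fin m => Bidual X) X
      ℂ).toContinuousLinearMap

set_option maxSynthPendingDepth 4 in
/-- The Arens extension of `m`-linear forms from `X` to `X**`:
`Ã (z₁, …, zₘ) = z₁ (x₁ ↦ z₂ (x₂ ↦ ⋯ zₘ (xₘ ↦ A (x₁, …, xₘ)) ⋯ ))`. -/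
def arens : ∀ m : ℕ, Form m X →L[ℂ] Form m (Bidual X)
  | 0 =>
    (continuousMultilinearCurryFin0 ℂ (Bidual X) ℂ).symm.toContinuousLinearEquiv.toContinuousLinearMap
      ∘L (continuousMultilinearCurryFin0 ℂ X ℂ).toContinuousLinearEquiv.toContinuousLinearMap
  | m + 1 =>
    (continuousMultilinearCurryLeftEquiv ℂ (fun _ : Fin (m + 1) => Bidual X)
        ℂ).symm.toContinuousLinearEquiv.toContinuousLinearMap
      ∘L arensStep X m
      ∘L ContinuousLinearMap.compL ℂ X (Form m X) (Form m (Bidual X)) (arens m)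
      ∘L (continuousMultilinearCurryLeftEquiv ℂ (fun _ : Fin (m + 1) => X)
        ℂ).toContinuousLinearEquiv.toContinuousLinearMap

variable {X}

theorem arens_zero (A : Form 0 X) (z : Fin 0 → Bidual X) : arens X 0 A z = A 0 := rfl

theorem arens_succ {m : ℕ} (A : Form (m + 1) X) (z : Fin (m + 1) → Bidual X) :
    arens X (m + 1) A z =
      z 0 (((arens X m) ∘L A.curryLeft).flipMultilinear (Fin.tail z)) := rfl

/-- `Ã` extends `A`. -/
theorem arens_inclusion {m : ℕ} (A : Form m X) (x : Fin m → X) :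
    arens X m A (fun i => NormedSpace.inclusionInDoubleDual ℂ X (x i)) = A x := by
  induction m with
  | zero => rw [arens_zero, Subsingleton.elim x 0]
  | succ m ih =>
    rw [arens_succ, NormedSpace.dual_def]
    change arens X m (A.curryLeft (x 0)) (fun i => NormedSpace.inclusionInDoubleDual ℂ X
      (Fin.tail x i)) = A x
    rw [ih, ContinuousMultilinearMap.curryLeft_apply, Fin.cons_self_tail]

/-- `Ã (x₁, …, x_{j-1}, z, z_{j+1}, …, zₘ)` is weak*-continuous in `z ∈ X**` when
`x₁, …, x_{j-1} ∈ X`. -/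
theorem arens_weakStar_continuous {m : ℕ} (A : Form m X) (j : Fin m) (v : Fin m → Bidual X)
    (hv : ∀ i < j, v i ∈ Set.range (NormedSpace.inclusionInDoubleDual ℂ X)) :
    Continuous fun z : WeakDual ℂ (StrongDual ℂ X) =>
      arens X m A (Function.update v j (WeakDual.toStrongDual z)) := by
  induction m with
  | zero => exact j.elim0
  | succ m ih =>
    obtain rfl | ⟨j, rfl⟩ := Fin.eq_zero_or_eq_succ j
    · have key : ∀ z : Bidual X, arens X (m + 1) A (Function.update v 0 z) =
          z (((arens X m) ∘L A.curryLeft).flipMultilinear (Fin.tail v)) := fun z => by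
        rw [arens_succ, Function.update_self, Fin.tail_update_zero]
      refine Continuous.congr ?_ fun z => (key (WeakDual.toStrongDual z)).symm
      exact WeakDual.eval_continuous _
    · obtain ⟨x, hx⟩ := hv 0 (Fin.succ_pos j)
      have key : ∀ z : Bidual X, arens X (m + 1) A (Function.update v j.succ z) =
          arens X m (A.curryLeft x) (Function.update (Fin.tail v) j z) := fun z => by
        rw [arens_succ, Function.update_of_ne (Fin.succ_ne_zero j).symm, ← hx,
          NormedSpace.dual_def, Fin.tail_update_succ]
        rfl
      refine Continuous.congr ?_ fun z => (key (WeakDual.toStrongDual z)).symm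
      exact ih (A.curryLeft x) j (Fin.tail v) fun i hi => hv i.succ (Fin.succ_lt_succ_iff.2 hi)

/-- The Aron–Berner extension `AB(P) = P̃ ∈ 𝒫(ᵐX**)` of `P ∈ 𝒫(ᵐX)`: the restriction to the
diagonal of the Arens extension of the symmetric form associated with `P`. -/
def aronBerner {m : ℕ} (P : HomPoly m X) : HomPoly m (Bidual X) :=
  ⟨fun z => arens X m P.symmForm fun _ => z, arens X m P.symmForm, fun _ => rfl⟩

end Extension

/-! ### `ℓ∞` as the bidual of `c₀` -/

/-- `c₀`: complex null sequences with the supremum norm. -/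
abbrev CZero : Type := C₀(ℕ, ℂ)

/-- `ℓ∞`: bounded complex sequences with the supremum norm. -/
abbrev LInfty : Type := lp (fun _ : ℕ => ℂ) ∞

/-- The unit vectors of `c₀`. -/
def unitVec (n : ℕ) : CZero where
  toFun := Pi.single n 1
  continuous_toFun := continuous_of_discreteTopology
  zero_at_infty' := by
    rw [cocompact_eq_atTop]
    refine tendsto_const_nhds.congr' ?_
    filter_upwards [eventually_gt_atTop n] with k hk
    simp [hk.ne']

theorem sum_norm_apply_unitVec_le (φ : StrongDual ℂ CZero) (s : Finset ℕ) :
    ∑ n ∈ s, ‖φ (unitVec n)‖ ≤ ‖φ‖ := by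
  choose c hc hcφ using fun n : ℕ => RCLike.exists_norm_eq_mul_self (φ (unitVec n))
  set x : CZero := ∑ n ∈ s, c n • unitVec n with hx
  have hval : ∀ k, x k = ∑ n ∈ s, c n * (Pi.single n (1 : ℂ) : ℕ → ℂ) k := by
    intro k
    have : x k = ∑ n ∈ s, (c n • unitVec n) k := by
      rw [hx]
      induction s using Finset.induction_on with
      | empty => simp
      | insert a t ha ih => simp [Finset.sum_insert ha, ih rfl]
    rw [this]; rfl
  have hx1 : ‖x‖ ≤ 1 := by
    rw [← ZeroAtInftyContinuousMap.norm_toBCF_eq_norm]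
    refine (BoundedContinuousFunction.norm_le zero_le_one).2 fun k => ?_
    change ‖x k‖ ≤ 1
    rw [hval]
    by_cases hk : k ∈ s
    · rw [Finset.sum_eq_single k]
      · simp [hc]
      · intro n _ hn; simp [hn.symm]
      · exact fun h => absurd hk h
    · rw [Finset.sum_eq_zero]
      · simp
      · intro n hn
        have : k ≠ n := fun h => hk (h ▸ hn)
        simp [this]
  have h1 : φ x = ((∑ n ∈ s, ‖φ (unitVec n)‖ : ℝ) : ℂ) := by
    rw [hx, map_sum, Complex.ofReal_sum]
    refine Finset.sum_congr rfl fun n _ => ?_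
    rw [_root_.map_smul, smul_eq_mul]
    exact (hcφ n).symm
  calc ∑ n ∈ s, ‖φ (unitVec n)‖ = ‖φ x‖ := by
        rw [h1, Complex.norm_real, Real.norm_of_nonneg (by positivity)]
    _ ≤ ‖φ‖ * ‖x‖ := φ.le_opNorm x
    _ ≤ ‖φ‖ := mul_le_of_le_one_right (norm_nonneg φ) hx1

theorem summable_norm_apply_unitVec (φ : StrongDual ℂ CZero) :
    Summable fun n => ‖φ (unitVec n)‖ :=
  summable_of_sum_le (fun _ => norm_nonneg _) (sum_norm_apply_unitVec_le φ)

theorem norm_mul_apply_unitVec_le (z : LInfty) (φ : StrongDual ℂ CZero) (n : ℕ) :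
    ‖z n * φ (unitVec n)‖ ≤ ‖z‖ * ‖φ (unitVec n)‖ := by
  rw [norm_mul]
  gcongr
  exact lp.norm_apply_le_norm ENNReal.top_ne_zero z n

theorem summable_mul_apply_unitVec (z : LInfty) (φ : StrongDual ℂ CZero) :
    Summable fun n => z n * φ (unitVec n) :=
  .of_norm_bounded ((summable_norm_apply_unitVec φ).mul_left ‖z‖) (norm_mul_apply_unitVec_le z φ)

/-- The canonical identification of `ℓ∞ = (ℓ₁)*` with the bidual of `c₀`: `z ∈ ℓ∞` acts on
`φ ∈ c₀* = ℓ₁` by `∑ zₙ φ(eₙ)`. -/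
def toBidual (z : LInfty) : Bidual CZero :=
  LinearMap.mkContinuous
    { toFun := fun φ => ∑' n, z n * φ (unitVec n)
      map_add' := fun φ χ => by
        rw [← (summable_mul_apply_unitVec z φ).tsum_add (summable_mul_apply_unitVec z χ)]
        simp [mul_add]
      map_smul' := fun c φ => by
        rw [RingHom.id_apply, smul_eq_mul, ← tsum_mul_left]
        simp [mul_left_comm] }
    ‖z‖ fun φ => by
      have hs := summable_norm_apply_unitVec φ
      calc ‖∑' n, z n * φ (unitVec n)‖ ≤ ∑' n, ‖z‖ * ‖φ (unitVec n)‖ :=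
            tsum_of_norm_bounded (hs.mul_left ‖z‖).hasSum (norm_mul_apply_unitVec_le z φ)
        _ = ‖z‖ * ∑' n, ‖φ (unitVec n)‖ := tsum_mul_left
        _ ≤ ‖z‖ * ‖φ‖ := by
          gcongr
          exact hs.tsum_le_of_sum_le (sum_norm_apply_unitVec_le φ)

theorem toBidual_apply (z : LInfty) (φ : StrongDual ℂ CZero) :
    toBidual z φ = ∑' n, z n * φ (unitVec n) := rfl

/-! ### The infinite polytorus and its Hardy spaces -/

instance : MeasurableSpace Circle := borel Circle

instance : BorelSpace Circle := ⟨rfl⟩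

/-- The infinite polytorus `𝕋^∞`. -/
abbrev Polytorus : Type := ℕ → Circle

/-- Normalized Lebesgue measure on `𝕋`: the image of the invariant probability on `ℝ/ℤ` under
`t ↦ exp (2πit)`. -/
def circleMeasure : Measure Circle :=
  (AddCircle.haarAddCircle (T := (1 : ℝ))).map AddCircle.toCircle

instance : IsProbabilityMeasure circleMeasure :=
  Measure.isProbabilityMeasure_map AddCircle.continuous_toCircle.aemeasurable

/-- The product of the normalized Lebesgue measures. -/
def polytorusMeasure : Measure Polytorus := Measure.infinitePi fun _ : ℕ => circleMeasure

instance : IsProbabilityMeasure polytorusMeasure :=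
  inferInstanceAs (IsProbabilityMeasure (Measure.infinitePi fun _ : ℕ => circleMeasure))

/-- A point of the polytorus, as a bounded sequence. -/
def Polytorus.toLInfty (w : Polytorus) : LInfty :=
  ⟨fun n => (w n : ℂ), memℓp_infty ⟨1, by rintro _ ⟨n, rfl⟩; exact (Circle.norm_coe _).le⟩⟩

/-- The monomial `w^α = ∏ wₙ^{αₙ}`, for a finitely supported `α` with integer entries. -/
def torusMonomial (α : ℕ →₀ ℤ) (w : Polytorus) : ℂ := α.prod fun n k => (w n : ℂ) ^ k

theorem continuous_torusMonomial (α : ℕ →₀ ℤ) : Continuous (torusMonomial α) := by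
  unfold torusMonomial Finsupp.prod
  refine continuous_finsetProd _ fun n _ => ?_
  exact (continuous_subtype_val.comp (continuous_apply n)).zpow₀ _ fun w => Or.inl (w n).coe_ne_zero

theorem norm_torusMonomial (α : ℕ →₀ ℤ) (w : Polytorus) : ‖torusMonomial α w‖ = 1 := by
  simp only [torusMonomial, Finsupp.prod, norm_prod, norm_zpow, Circle.norm_coe, one_zpow,
    Finset.prod_const_one]

/-- The Fourier coefficient `f̂(α) = ∫ f(w) w^{-α} dm(w)`. -/
def torusCoeff (f : Polytorus → ℂ) (α : ℕ →₀ ℤ) : ℂ :=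
  ∫ w, f w * torusMonomial (-α) w ∂polytorusMeasure

theorem torusCoeff_smul {p : ℝ≥0∞} (c : ℂ) (f : Lp ℂ p polytorusMeasure) (α : ℕ →₀ ℤ) :
    torusCoeff (c • f : Lp ℂ p polytorusMeasure) α = c * torusCoeff f α := by
  unfold torusCoeff
  rw [← integral_const_mul]
  refine integral_congr_ae ?_
  filter_upwards [Lp.coeFn_smul c f] with w hw
  rw [hw, Pi.smul_apply, smul_eq_mul, mul_assoc]

theorem torusCoeff_zero {p : ℝ≥0∞} (α : ℕ →₀ ℤ) : torusCoeff (0 : Lp ℂ p polytorusMeasure) α = 0 := by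
  simpa using torusCoeff_smul (p := p) 0 0 α

section Hardy

variable (p : ℝ≥0∞) [Fact (1 ≤ p)]

theorem integrable_mul_torusMonomial (f : Lp ℂ p polytorusMeasure) (α : ℕ →₀ ℤ) :
    Integrable (fun w => f w * torusMonomial α w) polytorusMeasure :=
  ((Lp.memLp f).integrable Fact.out).mul_bdd (c := 1)
    (continuous_torusMonomial α).aestronglyMeasurable (ae_of_all _ fun w => (norm_torusMonomial α w).le)

variable {p}

theorem torusCoeff_add (f g : Lp ℂ p polytorusMeasure) (α : ℕ →₀ ℤ) :
    torusCoeff (f + g : Lp ℂ p polytorusMeasure) α = torusCoeff f α + torusCoeff g α := by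
  unfold torusCoeff
  rw [← integral_add (integrable_mul_torusMonomial p f _) (integrable_mul_torusMonomial p g _)]
  refine integral_congr_ae ?_
  filter_upwards [Lp.coeFn_add f g] with w hw
  rw [hw, Pi.add_apply, add_mul]

variable (p)

/-- The Hardy space `H_p(𝕋^∞)`: the `f ∈ L_p(𝕋^∞)` with `f̂(α) = 0` whenever `α` has a negative
entry. -/
def hardy : Submodule ℂ (Lp ℂ p polytorusMeasure) where
  carrier := {f | ∀ α : ℕ →₀ ℤ, ¬ 0 ≤ α → torusCoeff f α = 0}
  zero_mem' := fun α _ => torusCoeff_zero α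
  add_mem' := fun {f g} hf hg α hα => by rw [torusCoeff_add, hf α hα, hg α hα, add_zero]
  smul_mem' := fun c f hf α hα => by rw [torusCoeff_smul, hf α hα, mul_zero]

/-- The homogeneous part `H_p^m(𝕋^∞)`: the `f ∈ H_p(𝕋^∞)` such that `f̂(α) ≠ 0` only if
`|α| = ∑ αₙ = m`. -/
def hardyHom (m : ℕ) : Submodule ℂ (Lp ℂ p polytorusMeasure) where
  carrier := {f | f ∈ hardy p ∧ ∀ α : ℕ →₀ ℤ, torusCoeff f α ≠ 0 → (α.sum fun _ k => k) = m}
  zero_mem' := ⟨zero_mem _, fun α h => absurd (torusCoeff_zero α) h⟩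
  add_mem' := fun {f g} hf hg => ⟨add_mem hf.1 hg.1, fun α h => by
    by_cases h1 : torusCoeff f α = 0
    · by_cases h2 : torusCoeff g α = 0
      · exact absurd (by rw [torusCoeff_add, h1, h2, add_zero]) h
      · exact hg.2 α h2
    · exact hf.2 α h1⟩
  smul_mem' := fun c f hf => ⟨Submodule.smul_mem _ c hf.1, fun α h =>
    hf.2 α fun h1 => h (by rw [torusCoeff_smul, h1, mul_zero])⟩

end Hardy

end AronBerner

end

open MeasureTheory Filter Topology
open scoped ENNReal ZeroAtInfty

noncomputable section

namespace AronBerner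

/-! ### Invariance of the measure on the polytorus -/

/-! Everything rests on one averaging identity. For `w` on the polytorus let `x` be its truncation
to the first `N` coordinates. Multiplying the remaining coordinates by `c` moves `w` to `x + c (w -
x)`, and the diagonal of the Arens extension along this line is a polynomial in `c` of degree at
most `m` with constant term `P x`. Averaging over the roots of unity `c` of order `m + 1` therefore
returns `P x` (`sum_torusExt_tailRot_mul`), and these rotations preserve the measure.

The identity gives both norm inequalities. An almost everywhere bound for the extension passes to
`P` on truncated torus points, then to the finite polydiscs by the maximum modulus principle and to
the unit ball of `c₀` by density (`HomPoly.norm_le_of_ae_norm_torusExt_le`). Conversely, `w ↦ P x`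
is the conditional expectation of the extension given the first `N` coordinates, so martingale
convergence makes the extension an almost everywhere limit of values bounded by `‖P‖`
(`ae_norm_torusExt_le`).

It also identifies the Fourier coefficients of the extension with the coefficients of `P`
(`torusCoeff_torusExt`), so the image lies in the Hardy space. For surjectivity, the part of the
Fourier series of `f` in the first `N` variables is an average of rotates of `f`, hence a polynomial
of norm at most `‖f‖`. Polarization makes the symmetric forms of these polynomials uniformly
bounded; a pointwise limit along an ultrafilter has the coefficients of `f`, and Fourier uniqueness
in `L²` finishes (`exists_torusExt_ae_eq`). -/

instance : circleMeasure.IsMulLeftInvariant where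
  map_mul_left_eq_self c := by
    obtain ⟨t, rfl⟩ := (AddCircle.homeomorphCircle (T := (1 : ℝ)) one_ne_zero).surjective c
    rw [AddCircle.homeomorphCircle_apply, circleMeasure,
      Measure.map_map (measurable_const_mul _) AddCircle.continuous_toCircle.measurable]
    have h : ((fun x => AddCircle.toCircle t * x) ∘ AddCircle.toCircle (T := (1 : ℝ))) =
        AddCircle.toCircle ∘ fun x => t + x := by
      ext x
      simp [AddCircle.toCircle_add]
    rw [h, ← Measure.map_map AddCircle.continuous_toCircle.measurable (measurable_const_add t),
      map_add_left_eq_self]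

instance : polytorusMeasure.IsMulLeftInvariant where
  map_mul_left_eq_self c := by
    have h := Measure.infinitePi_map_pi (μ := fun _ : ℕ => circleMeasure)
      (f := fun n x => c n * x) (fun n => measurable_const_mul (c n))
    simp only [map_mul_left_eq_self] at h
    exact h

/-- Lets an almost everywhere bound on a continuous function hold everywhere. -/
instance : polytorusMeasure.IsOpenPosMeasure :=
  isOpenPosMeasure_of_mulLeftInvariant_of_compact Set.univ isCompact_univ (by simp)

theorem torusMonomial_mul (α : ℕ →₀ ℤ) (v w : Polytorus) :
    torusMonomial α (v * w) = torusMonomial α v * torusMonomial α w := by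
  simp [torusMonomial, Finsupp.prod, mul_zpow, Finset.prod_mul_distrib]

theorem torusMonomial_add (α β : ℕ →₀ ℤ) (w : Polytorus) :
    torusMonomial (α + β) w = torusMonomial α w * torusMonomial β w :=
  Finsupp.prod_add_index' (fun _ => zpow_zero _) fun n _ _ => zpow_add₀ (w n).coe_ne_zero _ _

theorem torusMonomial_zero (w : Polytorus) : torusMonomial 0 w = 1 := Finsupp.prod_zero_index

theorem torusMonomial_neg (α : ℕ →₀ ℤ) (w : Polytorus) :
    torusMonomial (-α) w = star (torusMonomial α w) := by
  have h := torusMonomial_add α (-α) w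
  rw [add_neg_cancel, torusMonomial_zero] at h
  have h1 : torusMonomial α w * star (torusMonomial α w) = 1 := by
    have := RCLike.mul_conj (torusMonomial α w)
    rw [norm_torusMonomial] at this
    simpa using this
  have hne : torusMonomial α w ≠ 0 := left_ne_zero_of_mul_eq_one h1
  exact mul_left_cancel₀ hne (h.symm.trans h1.symm)

theorem exists_circle_zpow_ne_one {k : ℤ} (hk : k ≠ 0) : ∃ c : Circle, (c : ℂ) ^ k ≠ 1 := by
  -- The `k`-th power of `exp (iπ/k)` is `-1`.
  refine ⟨Circle.exp (Real.pi / k), fun h => ?_⟩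
  rw [Circle.coe_exp, ← Complex.exp_int_mul] at h
  have hk' : (k : ℂ) ≠ 0 := by exact_mod_cast hk
  have : (k : ℂ) * (((Real.pi / k : ℝ) : ℂ) * Complex.I) = Real.pi * Complex.I := by
    push_cast
    field_simp
  rw [this, Complex.exp_pi_mul_I] at h
  norm_num at h

theorem exists_torusMonomial_ne_one {α : ℕ →₀ ℤ} (hα : α ≠ 0) :
    ∃ c : Polytorus, torusMonomial α c ≠ 1 := by
  obtain ⟨n, hn⟩ := Finsupp.ne_iff.1 hα
  obtain ⟨c, hc⟩ := exists_circle_zpow_ne_one hn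
  refine ⟨Pi.mulSingle n c, ?_⟩
  rw [torusMonomial, Finsupp.prod, Finset.prod_eq_single n]
  · simpa using hc
  · intro k _ hk
    simp [Pi.mulSingle_eq_of_ne hk]
  · intro h
    exact absurd (Finsupp.notMem_support_iff.1 h) hn

/-- Characters other than the trivial one have mean zero. -/
theorem integral_torusMonomial (α : ℕ →₀ ℤ) :
    ∫ w, torusMonomial α w ∂polytorusMeasure = if α = 0 then 1 else 0 := by
  split_ifs with h
  · simp [h, torusMonomial_zero]
  · obtain ⟨c, hc⟩ := exists_torusMonomial_ne_one h
    -- Translation by `c` multiplies the integral by a factor different from `1` and yet preserves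
    -- it.
    have h1 := integral_mul_left_eq_self (μ := polytorusMeasure) (torusMonomial α) c
    simp only [torusMonomial_mul, integral_const_mul] at h1
    by_contra h0
    exact hc (mul_right_cancel₀ h0 (h1.trans (one_mul _).symm))

theorem torusCoeff_congr {f g : Polytorus → ℂ} (h : f =ᵐ[polytorusMeasure] g) (α : ℕ →₀ ℤ) :
    torusCoeff f α = torusCoeff g α :=
  integral_congr_ae (h.mul (ae_eq_refl _))

theorem torusCoeff_translate (f : Polytorus → ℂ) (c : Polytorus) (α : ℕ →₀ ℤ) :
    torusCoeff (fun w => f (c * w)) α = torusMonomial α c * torusCoeff f α := by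
  have h := integral_mul_left_eq_self (μ := polytorusMeasure)
    (fun w => f w * torusMonomial (-α) w) c
  have hc : torusMonomial α c * torusMonomial (-α) c = 1 := by
    rw [← torusMonomial_add, add_neg_cancel, torusMonomial_zero]
  rw [torusCoeff, torusCoeff, ← h, ← integral_const_mul]
  refine integral_congr_ae (ae_of_all _ fun w => ?_)
  simp only [torusMonomial_mul]
  linear_combination (-f (c * w) * torusMonomial (-α) w) * hc

/-! ### Uniqueness of Fourier coefficients -/

/-- The monomials as continuous functions. -/
def monomialMap (α : ℕ →₀ ℤ) : C(Polytorus, ℂ) := ⟨torusMonomial α, continuous_torusMonomial α⟩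

/-- The trigonometric polynomials. -/
def trigPolynomials : StarSubalgebra ℂ C(Polytorus, ℂ) where
  toSubalgebra := Algebra.adjoin ℂ (Set.range monomialMap)
  star_mem' := by
    change Algebra.adjoin ℂ (Set.range monomialMap) ≤
      star (Algebra.adjoin ℂ (Set.range monomialMap))
    refine Algebra.adjoin_le ?_
    rintro _ ⟨α, rfl⟩
    refine Algebra.subset_adjoin ⟨-α, ?_⟩
    ext w
    exact torusMonomial_neg α w

theorem trigPolynomials_coe :
    trigPolynomials.toSubalgebra.toSubmodule = Submodule.span ℂ (Set.range monomialMap) := by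
  apply Algebra.adjoin_eq_span_of_subset
  refine .trans (fun x ↦ Submonoid.closure_induction (fun _ ↦ id) ⟨0, ?_⟩ ?_) Submodule.subset_span
  · ext w
    exact torusMonomial_zero w
  · rintro _ _ _ _ ⟨α, rfl⟩ ⟨β, rfl⟩
    exact ⟨α + β, ContinuousMap.ext fun w => torusMonomial_add α β w⟩

theorem trigPolynomials_separatesPoints : trigPolynomials.SeparatesPoints := by
  intro v w hvw
  obtain ⟨n, hn⟩ := Function.ne_iff.1 hvw
  refine ⟨_, ⟨monomialMap (Finsupp.single n 1),
    Algebra.subset_adjoin ⟨Finsupp.single n 1, rfl⟩, rfl⟩, ?_⟩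
  have h : ∀ u, monomialMap (Finsupp.single n 1) u = u n := fun u => by
    simp [monomialMap, torusMonomial]
  dsimp only
  rw [h, h, Ne, Circle.coe_inj]
  exact hn

theorem span_monomialMap_closure_eq_top :
    (Submodule.span ℂ (Set.range monomialMap)).topologicalClosure = ⊤ := by
  rw [← trigPolynomials_coe]
  exact congr_arg (Subalgebra.toSubmodule <| StarSubalgebra.toSubalgebra ·)
    (ContinuousMap.starSubalgebra_topologicalClosure_eq_top_of_separatesPoints _
      trigPolynomials_separatesPoints)

theorem span_toLp_monomialMap_closure_eq_top :
    (Submodule.span ℂ (Set.range fun α => ContinuousMap.toLp (E := ℂ) 2 polytorusMeasure ℂ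
      (monomialMap α))).topologicalClosure = ⊤ := by
  convert!
    (ContinuousMap.toLp_denseRange ℂ polytorusMeasure ℂ
      (ENNReal.ofNat_ne_top (n := 2))).topologicalClosure_map_submodule
      span_monomialMap_closure_eq_top
  rw [Submodule.map_span, Set.range_comp']
  rfl

/-- A square-integrable function whose Fourier coefficients all vanish is zero. -/
theorem ae_eq_zero_of_torusCoeff_eq_zero {f : Polytorus → ℂ} (hf : MemLp f 2 polytorusMeasure)
    (h : ∀ α, torusCoeff f α = 0) : f =ᵐ[polytorusMeasure] 0 := by
  have hperp : ∀ x ∈ Submodule.span ℂ (Set.range fun α => ContinuousMap.toLp (E := ℂ) 2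
      polytorusMeasure ℂ (monomialMap α)), inner ℂ x (hf.toLp f) = 0 := by
    intro x hx
    induction hx using Submodule.span_induction with
    | mem x hx =>
      obtain ⟨α, rfl⟩ := hx
      rw [L2.inner_def, ← h α, torusCoeff]
      refine integral_congr_ae ?_
      filter_upwards [hf.coeFn_toLp, ContinuousMap.coeFn_toLp (p := 2) (𝕜 := ℂ) polytorusMeasure
        (monomialMap α)] with w h1 h2
      rw [h1, h2, torusMonomial_neg]
      rfl
    | zero => simp
    | add x y _ _ hx hy => rw [inner_add_left, hx, hy, add_zero]
    | smul c x _ hx => rw [inner_smul_left, hx, mul_zero]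
  have h0 : hf.toLp f = 0 := by
    refine (Submodule.dense_iff_topologicalClosure_eq_top.2
      span_toLp_monomialMap_closure_eq_top).eq_zero_of_inner_right ℂ fun x hx => ?_
    exact hperp x hx
  exact hf.coeFn_toLp.symm.trans (h0 ▸ Lp.coeFn_zero ℂ 2 polytorusMeasure)

theorem ae_eq_of_torusCoeff_eq {f g : Polytorus → ℂ} (hf : MemLp f 2 polytorusMeasure)
    (hg : MemLp g 2 polytorusMeasure) (h : ∀ α, torusCoeff f α = torusCoeff g α) :
    f =ᵐ[polytorusMeasure] g := by
  have hint : ∀ {u : Polytorus → ℂ}, MemLp u 2 polytorusMeasure → ∀ α,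
      Integrable (fun w => u w * torusMonomial α w) polytorusMeasure := fun hu α =>
    (hu.integrable one_le_two).mul_bdd (c := 1) (continuous_torusMonomial α).aestronglyMeasurable
      (ae_of_all _ fun w => (norm_torusMonomial α w).le)
  have h0 := ae_eq_zero_of_torusCoeff_eq_zero (hf.sub hg) fun α => by
    have := h α
    rw [torusCoeff, torusCoeff, ← sub_eq_zero, ← integral_sub (hint hf _) (hint hg _)] at this
    simpa [torusCoeff, sub_mul] using this
  filter_upwards [h0] with w hw
  exact sub_eq_zero.1 hw

/-! ### Averaging over roots of unity -/

/-- A primitive root of unity of order `m + 1` on the circle. -/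
def circleRoot (m : ℕ) : Circle := Circle.exp (2 * Real.pi / (m + 1 : ℕ))

theorem isPrimitiveRoot_circleRoot (m : ℕ) : IsPrimitiveRoot (circleRoot m : ℂ) (m + 1) := by
  have h := Complex.isPrimitiveRoot_exp (m + 1) m.succ_ne_zero
  convert! h using 1
  rw [circleRoot, Circle.coe_exp]
  push_cast
  ring_nf

theorem sum_circleRoot_pow {m k : ℕ} (hk : k ≤ m) :
    ∑ j ∈ Finset.range (m + 1), ((circleRoot m : ℂ) ^ j) ^ k = if k = 0 then (m + 1 : ℂ) else 0 := by
  split_ifs with h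
  · simp [h]
  · have hz := isPrimitiveRoot_circleRoot m
    have hne : (circleRoot m : ℂ) ^ k ≠ 1 := hz.pow_ne_one_of_pos_of_lt h (by omega)
    simp only [← pow_mul, mul_comm _ k]
    simp only [pow_mul]
    rw [geom_sum_eq hne, ← pow_mul, mul_comm k, pow_mul, hz.pow_eq_one]
    simp

/-- The mean value property of `λ ↦ A (x + λ y, …, x + λ y)` over roots of unity. -/
theorem sum_form_add_circleRoot_smul {m : ℕ} {E : Type*} [NormedAddCommGroup E] [NormedSpace ℂ E]
    (A : Form m E) (x y : E) :
    ∑ j ∈ Finset.range (m + 1), (A fun _ => x + (circleRoot m : ℂ) ^ j • y) =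
      (m + 1) * A fun _ => x := by
  classical
  -- Multilinear expansion, where `s` is the set of slots filled with `c • y`. The exponents
  -- `s.card` are at most `m`, so the roots of order `m + 1` annihilate every term except `s = ∅`.
  have h : ∀ c : ℂ, (A fun _ => x + c • y) =
      ∑ s : Finset (Fin m), c ^ s.card * A (s.piecewise (fun _ => y) fun _ => x) := by
    intro c
    have h1 := A.map_add_univ (fun _ => c • y) (fun _ => x)
    have h2 : (fun _ : Fin m => x + c • y) = (fun _ => c • y) + fun _ => x := by
      ext; simp [add_comm]
    rw [h2, h1]
    refine Finset.sum_congr rfl fun s _ => ?_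
    have h3 : s.piecewise (fun _ => c • y) (fun _ => x) =
        fun i => (if i ∈ s then c else 1) • s.piecewise (fun _ => y) (fun _ => x) i := by
      ext i
      by_cases hi : i ∈ s <;> simp [hi]
    rw [h3, A.map_smul_univ]
    simp
  simp only [h]
  rw [Finset.sum_comm]
  simp only [← Finset.sum_mul]
  rw [Finset.sum_eq_single ∅]
  · rw [sum_circleRoot_pow (by simp)]
    simp
  · intro s _ hs
    rw [sum_circleRoot_pow (by simpa using s.card_le_univ), if_neg (by simpa using hs), zero_mul]
  · simp

/-! ### Truncations and rotations -/

/-- The truncation of a sequence to its first `N` coordinates. -/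
def trunc (N : ℕ) (z : ℕ → ℂ) : CZero := ∑ n ∈ Finset.range N, z n • unitVec n

theorem trunc_apply (N : ℕ) (z : ℕ → ℂ) (k : ℕ) : trunc N z k = if k < N then z k else 0 := by
  have h : trunc N z k = ∑ n ∈ Finset.range N, z n * (Pi.single n (1 : ℂ) : ℕ → ℂ) k := by
    induction N with
    | zero => simp [trunc]
    | succ N ih =>
      rw [Finset.sum_range_succ, ← ih, trunc, trunc, Finset.sum_range_succ]
      rfl
  rw [h]
  split_ifs with hk
  · rw [Finset.sum_eq_single k]
    · simp
    · intro n _ hn; simp [hn.symm]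
    · intro hk'; exact absurd (Finset.mem_range.2 hk) hk'
  · refine Finset.sum_eq_zero fun n hn => ?_
    have : k ≠ n := fun h => hk (h ▸ Finset.mem_range.1 hn)
    simp [this]

theorem CZero.norm_le {x : CZero} {C : ℝ} (hC : 0 ≤ C) : ‖x‖ ≤ C ↔ ∀ n, ‖x n‖ ≤ C := by
  rw [← ZeroAtInftyContinuousMap.norm_toBCF_eq_norm, BoundedContinuousFunction.norm_le hC]
  rfl

theorem norm_trunc_le {N : ℕ} {z : ℕ → ℂ} (hz : ∀ n, ‖z n‖ ≤ 1) : ‖trunc N z‖ ≤ 1 := by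
  refine (CZero.norm_le zero_le_one).2 fun n => ?_
  rw [trunc_apply]
  split_ifs
  · exact hz n
  · simp

theorem tendsto_trunc (x : CZero) : Tendsto (fun N => trunc N x) atTop (𝓝 x) := by
  rw [Metric.tendsto_atTop]
  intro ε hε
  have hx : Tendsto x atTop (𝓝 0) := by
    have := x.zero_at_infty'
    rwa [cocompact_eq_atTop] at this
  obtain ⟨N, hN⟩ := Metric.tendsto_atTop.1 hx (ε / 2) (by positivity)
  refine ⟨N, fun M hM => ?_⟩
  rw [dist_eq_norm]
  refine lt_of_le_of_lt ((CZero.norm_le (by positivity : 0 ≤ ε / 2)).2 fun n => ?_) (by linarith)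
  rw [ZeroAtInftyContinuousMap.sub_apply, trunc_apply]
  split_ifs with h
  · simp; positivity
  · have := hN n (by omega)
    rw [dist_zero_right] at this
    simpa using this.le

/-- The point of the polytorus rotating by `c` all coordinates from the `N`-th on. -/
def tailRot (N : ℕ) (c : Circle) : Polytorus := fun n => if n < N then 1 else c

/-- The coordinates of a point of the polytorus. -/
abbrev Polytorus.coords (w : Polytorus) : ℕ → ℂ := fun n => w n

/-- The rotation fixes the truncation of `w` and multiplies the tail by `c`. The rotates thus lie on
a complex line through a point of `c₀`, as the mean value property requires. -/
theorem toBidual_tailRot_mul (N : ℕ) (c : Circle) (w : Polytorus) :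
    toBidual (tailRot N c * w).toLInfty =
      NormedSpace.inclusionInDoubleDual ℂ CZero (trunc N w.coords) + (c : ℂ) •
        (toBidual w.toLInfty -
          NormedSpace.inclusionInDoubleDual ℂ CZero (trunc N w.coords)) := by
  ext φ
  have key : ∀ v : Polytorus, toBidual v.toLInfty φ =
      ∑ n ∈ Finset.range N, (v n : ℂ) * φ (unitVec n) +
        ∑' n, (v (n + N) : ℂ) * φ (unitVec (n + N)) := fun v =>
    ((summable_mul_apply_unitVec v.toLInfty φ).sum_add_tsum_nat_add N).symm
  have ht : NormedSpace.inclusionInDoubleDual ℂ CZero (trunc N w.coords) φ =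
      ∑ n ∈ Finset.range N, (w n : ℂ) * φ (unitVec n) := by
    rw [NormedSpace.dual_def, trunc, map_sum]
    simp
  have h1 : ∑ n ∈ Finset.range N, ((tailRot N c * w) n : ℂ) * φ (unitVec n) =
      ∑ n ∈ Finset.range N, (w n : ℂ) * φ (unitVec n) :=
    Finset.sum_congr rfl fun n hn => by simp [tailRot, Finset.mem_range.1 hn]
  have h2 : ∑' n, ((tailRot N c * w) (n + N) : ℂ) * φ (unitVec (n + N)) =
      c * ∑' n, (w (n + N) : ℂ) * φ (unitVec (n + N)) := by
    rw [← tsum_mul_left]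
    exact tsum_congr fun n => by simp [tailRot, mul_assoc]
  simp only [_root_.add_apply, _root_.smul_apply, _root_.sub_apply, smul_eq_mul, ht, key, h1, h2]
  ring

/-! ### The Aron–Berner extension on the polytorus -/

/-- The restriction of the Aron–Berner extension to the polytorus. -/
def torusExt {m : ℕ} (P : HomPoly m CZero) (w : Polytorus) : ℂ :=
  aronBerner P (toBidual w.toLInfty)

/-- The central identity. About the Arens extension it uses only multilinearity and agreement with
the original form on `c₀`. -/
theorem sum_torusExt_tailRot_mul {m : ℕ} (P : HomPoly m CZero) (N : ℕ) (w : Polytorus) :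
    ∑ j ∈ Finset.range (m + 1), torusExt P (tailRot N (circleRoot m ^ j) * w) =
      (m + 1) * P (trunc N w.coords) := by
  have h := sum_form_add_circleRoot_smul (arens CZero m P.symmForm)
    (NormedSpace.inclusionInDoubleDual ℂ CZero (trunc N w.coords))
    (toBidual w.toLInfty - NormedSpace.inclusionInDoubleDual ℂ CZero (trunc N w.coords))
  rw [arens_inclusion, ← P.symmForm_diag] at h
  rw [← h]
  refine Finset.sum_congr rfl fun j _ => ?_
  rw [torusExt, toBidual_tailRot_mul, Circle.coe_pow]
  rfl

/-- The outermost functional acts as a convergent series whose terms involve the extensions of the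
`m`-linear forms `A.curryLeft (unitVec n)`; induction on the degree then exhibits a pointwise limit
of measurable functions. -/
theorem measurable_arens_toBidual {m : ℕ} (A : Form m CZero) :
    Measurable fun w : Polytorus => arens CZero m A fun _ => toBidual w.toLInfty := by
  induction m with
  | zero => exact measurable_const
  | succ m ih =>
    have hval : ∀ w : Polytorus, Tendsto (fun N => ∑ n ∈ Finset.range N, (w n : ℂ) *
        arens CZero m (A.curryLeft (unitVec n)) fun _ => toBidual w.toLInfty) atTop
        (𝓝 (arens CZero (m + 1) A fun _ => toBidual w.toLInfty)) := fun w =>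
      (summable_mul_apply_unitVec w.toLInfty
        (((arens CZero m) ∘L A.curryLeft).flipMultilinear
          fun _ => toBidual w.toLInfty)).hasSum.tendsto_sum_nat
    refine measurable_of_tendsto_metrizable (fun N => ?_) (tendsto_pi_nhds.2 hval)
    refine Finset.measurable_sum _ fun n _ => ?_
    exact (continuous_subtype_val.comp (continuous_apply n)).measurable.mul (ih _)

theorem measurable_torusExt {m : ℕ} (P : HomPoly m CZero) : Measurable (torusExt P) :=
  measurable_arens_toBidual P.symmForm

theorem norm_toBidual_toLInfty_le (w : Polytorus) : ‖toBidual w.toLInfty‖ ≤ 1 := by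
  refine (LinearMap.mkContinuous_norm_le _ (norm_nonneg _) _).trans ?_
  exact lp.norm_le_of_forall_le zero_le_one fun n => (Circle.norm_coe _).le

theorem exists_norm_torusExt_le {m : ℕ} (P : HomPoly m CZero) : ∃ C, ∀ w, ‖torusExt P w‖ ≤ C :=
  ⟨‖aronBerner P‖, fun w => (aronBerner P).norm_apply_le (norm_toBidual_toLInfty_le w)⟩

theorem memLp_torusExt {m : ℕ} (P : HomPoly m CZero) (p : ℝ≥0∞) :
    MemLp (torusExt P) p polytorusMeasure := by
  obtain ⟨C, hC⟩ := exists_norm_torusExt_le P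
  exact MemLp.of_bound (measurable_torusExt P).aestronglyMeasurable C (ae_of_all _ hC)

/-! ### The norm of a polynomial is attained on the polytorus -/

theorem HomPoly.continuous {m : ℕ} {X : Type*} [NormedAddCommGroup X] [NormedSpace ℂ X]
    (P : HomPoly m X) : Continuous P := by
  obtain ⟨A, hA⟩ := P.exists_form
  rw [show (P : X → ℂ) = fun x => A fun _ => x from funext hA]
  exact A.cont.comp (continuous_pi fun _ => continuous_id)

theorem HomPoly.differentiable {m : ℕ} {X : Type*} [NormedAddCommGroup X] [NormedSpace ℂ X]
    (P : HomPoly m X) : Differentiable ℂ P := by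
  obtain ⟨A, hA⟩ := P.exists_form
  rw [show (P : X → ℂ) = fun x => A fun _ => x from funext hA]
  exact (A.contDiff (n := 1)).differentiable one_ne_zero |>.comp
    (differentiable_pi.2 fun _ => differentiable_id)

theorem continuous_trunc_coords (N : ℕ) :
    Continuous fun w : Polytorus => trunc N w.coords :=
  continuous_finsetSum _ fun n _ =>
    (show Continuous fun w : Polytorus => w.coords n from
      continuous_subtype_val.comp (continuous_apply n)).smul continuous_const

theorem trunc_congr {N : ℕ} {y z : ℕ → ℂ} (h : ∀ n < N, y n = z n) : trunc N y = trunc N z :=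
  Finset.sum_congr rfl fun n hn => by rw [h n (Finset.mem_range.1 hn)]

theorem ae_comp_mul_left {p : Polytorus → Prop} (h : ∀ᵐ w ∂polytorusMeasure, p w)
    (c : Polytorus) : ∀ᵐ w ∂polytorusMeasure, p (c * w) :=
  (measurePreserving_mul_left polytorusMeasure c).quasiMeasurePreserving.ae h

theorem norm_apply_trunc_coords_le {m : ℕ} {P : HomPoly m CZero} {C : ℝ}
    (h : ∀ᵐ w ∂polytorusMeasure, ‖torusExt P w‖ ≤ C) (N : ℕ) (w : Polytorus) :
    ‖P (trunc N w.coords)‖ ≤ C := by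
  have hae : ∀ᵐ w ∂polytorusMeasure, ‖P (trunc N w.coords)‖ ≤ C := by
    filter_upwards [ae_all_iff.2 fun j : ℕ => ae_comp_mul_left h (tailRot N (circleRoot m ^ j))]
      with w hw
    have h1 := norm_sum_le_of_le (Finset.range (m + 1)) fun j _ => hw j
    rw [sum_torusExt_tailRot_mul, norm_mul, Finset.sum_const, Finset.card_range, nsmul_eq_mul,
      ← Nat.cast_succ, Complex.norm_natCast] at h1
    exact le_of_mul_le_mul_left h1 (by positivity)
  -- The exceptional set is open and null, hence empty.
  have hopen : IsOpen {w : Polytorus | C < ‖P (trunc N w.coords)‖} :=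
    isOpen_lt continuous_const (P.continuous.comp (continuous_trunc_coords N)).norm
  have hnull : polytorusMeasure {w : Polytorus | C < ‖P (trunc N w.coords)‖} = 0 := by
    simpa [ae_iff] using hae
  have hempty := hopen.measure_eq_zero_iff polytorusMeasure |>.1 hnull
  by_contra hw
  exact (hempty ▸ (not_le.1 hw : w ∈ {w : Polytorus | C < ‖P (trunc N w.coords)‖}) :
    w ∈ (∅ : Set Polytorus))

/-- The maximum modulus principle on the polydisc, one coordinate at a time. -/
theorem norm_apply_trunc_le {m : ℕ} {P : HomPoly m CZero} {C : ℝ} {N : ℕ}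
    (h : ∀ w : Polytorus, ‖P (trunc N w.coords)‖ ≤ C) {z : ℕ → ℂ} (hz : ∀ n, ‖z n‖ ≤ 1) :
    ‖P (trunc N z)‖ ≤ C := by
  -- Only the first `k` coordinates may lie off the circle; each induction step moves one of them to
  -- the circle by the maximum principle in that variable.
  have key : ∀ k : ℕ, ∀ z : ℕ → ℂ, (∀ n, ‖z n‖ ≤ 1) → (∀ n, k ≤ n → ‖z n‖ = 1) →
      ‖P (trunc N z)‖ ≤ C := by
    intro k
    induction k with
    | zero =>
      intro z _ hz
      exact h fun n => ⟨z n, by simpa [Submonoid.unitSphere] using hz n n.zero_le⟩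
    | succ k ih =>
      intro z hz1 hz2
      have hd : Differentiable ℂ fun t : ℂ => P (trunc N (Function.update z k t)) := by
        refine P.differentiable.comp ?_
        unfold trunc
        refine Differentiable.fun_sum fun n _ => ?_
        refine Differentiable.smul_const ?_ _
        by_cases hn : n = k
        · subst hn
          simp only [Function.update_self]
          exact differentiable_id
        · simp only [Function.update_of_ne hn]
          exact differentiable_const _
      have := Complex.norm_le_of_forall_mem_frontier_norm_le (Metric.isBounded_ball (x := (0 : ℂ))
        (r := 1)) hd.diffContOnCl (C := C) (fun t ht => by
          rw [frontier_ball _ one_ne_zero, mem_sphere_zero_iff_norm] at ht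
          refine ih _ (fun n => ?_) fun n hn => ?_
          · by_cases hnk : n = k
            · subst hnk; simp [ht]
            · simp [Function.update_of_ne hnk, hz1]
          · by_cases hnk : n = k
            · subst hnk; simp [ht]
            · rw [Function.update_of_ne hnk]
              exact hz2 n (by omega)) (z := z k) (by
          rw [closure_ball _ one_ne_zero, mem_closedBall_zero_iff]
          exact hz1 k)
      simpa using this
  -- The truncation ignores coordinates from `N` on, so they may be set to `1`.
  have h1 := key N (fun n => if n < N then z n else 1)
    (fun n => by split_ifs <;> simp [hz]) fun n hn => by simp [hn.not_gt]
  rwa [trunc_congr (z := z) fun n hn => by simp [hn]] at h1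

theorem HomPoly.norm_le_of_ae_norm_torusExt_le {m : ℕ} {P : HomPoly m CZero} {C : ℝ}
    (h : ∀ᵐ w ∂polytorusMeasure, ‖torusExt P w‖ ≤ C) : ‖P‖ ≤ C := by
  refine HomPoly.norm_le fun x hx => ?_
  refine le_of_tendsto ((P.continuous.tendsto x).comp (tendsto_trunc x)).norm
    (Eventually.of_forall fun N => ?_)
  exact norm_apply_trunc_le (norm_apply_trunc_coords_le h N)
    ((CZero.norm_le zero_le_one).1 hx)

/-! ### The Aron–Berner extension has the same norm -/

theorem tailRot_mul_apply {N n : ℕ} (hn : n < N) (c : Circle) (w : Polytorus) :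
    (tailRot N c * w) n = w n := by
  simp [tailRot, hn]

/-- All tail rotates of the extension have the same integral over an invariant set, and their
average is the truncated polynomial. This is the defining property of the conditional expectation.
-/
theorem setIntegral_torusExt {m : ℕ} (P : HomPoly m CZero) {N : ℕ} {s : Set Polytorus}
    (hs : MeasurableSet s) (hinv : ∀ c w, tailRot N c * w ∈ s ↔ w ∈ s) :
    ∫ w in s, torusExt P w ∂polytorusMeasure =
      ∫ w in s, P (trunc N w.coords) ∂polytorusMeasure := by
  have hrot : ∀ c, ∫ w in s, torusExt P (tailRot N c * w) ∂polytorusMeasure =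
      ∫ w in s, torusExt P w ∂polytorusMeasure := by
    intro c
    rw [← integral_indicator hs, ← integral_indicator hs,
      ← integral_mul_left_eq_self (s.indicator (torusExt P)) (tailRot N c)]
    refine integral_congr_ae (ae_of_all _ fun w => ?_)
    by_cases hw : w ∈ s
    · simp [hw, (hinv c w).2 hw]
    · dsimp only
      rw [Set.indicator_of_notMem hw, Set.indicator_of_notMem (mt (hinv c w).1 hw)]
  have hint : ∀ c, Integrable (fun w => torusExt P (tailRot N c * w))
      (polytorusMeasure.restrict s) := fun c =>
    (((memLp_torusExt P 1).integrable le_rfl).comp_mul_left (tailRot N c)).integrableOn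
  have hm : (m + 1 : ℂ) ≠ 0 := by exact_mod_cast m.succ_ne_zero
  refine mul_left_cancel₀ hm ?_
  calc (m + 1 : ℂ) * ∫ w in s, torusExt P w ∂polytorusMeasure
      = ∫ w in s, ∑ j ∈ Finset.range (m + 1), torusExt P (tailRot N (circleRoot m ^ j) * w)
          ∂polytorusMeasure := by
        rw [integral_finsetSum _ fun j _ => hint _]
        simp [hrot]
    _ = (m + 1) * ∫ w in s, P (trunc N w.coords) ∂polytorusMeasure := by
        rw [← integral_const_mul]
        exact integral_congr_ae (ae_of_all _ fun w => sum_torusExt_tailRot_mul P N w)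

theorem measurable_piLE_apply_trunc {m : ℕ} (P : HomPoly m CZero) (N : ℕ) :
    Measurable[Filtration.piLE N] fun w : Polytorus => P (trunc (N + 1) w.coords) := by
  -- Padding with `1` factors the function through the coordinates `0, …, N`.
  let e : ((i : Finset.Iic N) → Circle) → Polytorus :=
    fun v n => if h : n ∈ Finset.Iic N then v ⟨n, h⟩ else 1
  have he : Continuous e := continuous_pi fun n => by
    by_cases h : n ∈ Finset.Iic N
    · simp only [e, h, dite_true]
      exact continuous_apply _
    · simp only [e, h, dite_false]
      exact continuous_const
  have heq : (fun w : Polytorus => P (trunc (N + 1) w.coords)) =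
      (fun v => P (trunc (N + 1) (e v).coords)) ∘ Preorder.frestrictLe N := by
    ext w
    refine congrArg P (trunc_congr fun n hn => ?_)
    have : n ∈ Finset.Iic N := Finset.mem_Iic.2 (by omega)
    simp [e, Nat.lt_succ_iff.1 hn, Polytorus.coords]
  rw [heq, Filtration.piLE_eq_comap_frestrictLe]
  exact (P.continuous.comp ((continuous_trunc_coords _).comp he)).measurable.comp
    (comap_measurable _)

/-- `Filtration.piLE N` sees the `N + 1` coordinates `0, …, N`, hence the truncation at `N + 1`. The
functional `L` stands for the real or the imaginary part, since martingale convergence is applied to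
real functions. -/
theorem condExp_piLE_torusExt {m : ℕ} (P : HomPoly m CZero) (L : ℂ →L[ℝ] ℝ) (N : ℕ) :
    (fun w => L (P (trunc (N + 1) w.coords))) =ᵐ[polytorusMeasure]
      polytorusMeasure[fun w => L (torusExt P w) | Filtration.piLE N] := by
  have hint : Integrable (torusExt P) polytorusMeasure :=
    (memLp_torusExt P 1).integrable le_rfl
  have hint' : Integrable (fun w : Polytorus => P (trunc (N + 1) w.coords)) polytorusMeasure :=
    Integrable.of_bound (P.continuous.comp (continuous_trunc_coords _)).aestronglyMeasurable ‖P‖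
      (ae_of_all _ fun w => P.norm_apply_le (norm_trunc_le fun n => (Circle.norm_coe _).le))
  refine ae_eq_condExp_of_forall_setIntegral_eq (Filtration.piLE.le N) (L.integrable_comp hint)
    (fun s _ _ => (L.integrable_comp hint').integrableOn) (fun s hs _ => ?_) ?_
  · have hs' := Filtration.piLE.le N s hs
    rw [Filtration.piLE_eq_comap_frestrictLe] at hs
    obtain ⟨t, _, rfl⟩ := hs
    rw [L.integral_comp_comm hint'.integrableOn, L.integral_comp_comm hint.integrableOn,
      setIntegral_torusExt P (N := N + 1) hs' fun c w => ?_]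
    rw [Set.mem_preimage, Set.mem_preimage]
    have : Preorder.frestrictLe N (tailRot (N + 1) c * w) = Preorder.frestrictLe N w := by
      ext ⟨n, hn⟩
      exact congrArg _ (tailRot_mul_apply (Nat.lt_succ_iff.2 (Finset.mem_Iic.1 hn)) c w)
    rw [this]
  · exact (L.continuous.measurable.comp
      (measurable_piLE_apply_trunc P N)).stronglyMeasurable.aestronglyMeasurable

theorem iSup_piLE : (⨆ N, (Filtration.piLE (X := fun _ : ℕ => Circle)) N) = MeasurableSpace.pi := by
  refine le_antisymm (iSup_le fun N => Filtration.piLE.le N) ?_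
  refine iSup_le fun n => ?_
  refine le_trans ?_ (le_iSup _ n)
  rw [Filtration.piLE_eq_comap_frestrictLe]
  intro s hs
  obtain ⟨t, ht, rfl⟩ := hs
  exact ⟨(fun v => v ⟨n, Finset.mem_Iic.2 le_rfl⟩) ⁻¹' t, measurable_pi_apply _ ht, rfl⟩

/-- Lévy's upward theorem: the coordinate filtration generates the whole σ-algebra. -/
theorem tendsto_ae_torusExt {m : ℕ} (P : HomPoly m CZero) (L : ℂ →L[ℝ] ℝ) :
    ∀ᵐ w ∂polytorusMeasure, Tendsto (fun N => L (P (trunc (N + 1) w.coords))) atTop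
      (𝓝 (L (torusExt P w))) := by
  have h := Integrable.tendsto_ae_condExp (ℱ := Filtration.piLE (X := fun _ : ℕ => Circle))
    (L.integrable_comp ((memLp_torusExt P 1).integrable le_rfl)) (by
      rw [iSup_piLE]
      exact (L.continuous.measurable.comp (measurable_torusExt P)).stronglyMeasurable)
  filter_upwards [h, ae_all_iff.2 (condExp_piLE_torusExt P L)] with w h1 h2
  simpa only [h2] using h1

theorem ae_norm_torusExt_le {m : ℕ} (P : HomPoly m CZero) :
    ∀ᵐ w ∂polytorusMeasure, ‖torusExt P w‖ ≤ ‖P‖ := by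
  filter_upwards [tendsto_ae_torusExt P Complex.reCLM, tendsto_ae_torusExt P Complex.imCLM]
    with w hre him
  have h : Tendsto (fun N => P (trunc (N + 1) w.coords)) atTop (𝓝 (torusExt P w)) :=
    Complex.equivRealProdCLM.toHomeomorph.isInducing.tendsto_nhds_iff.2 (hre.prodMk_nhds him)
  exact le_of_tendsto h.norm (Eventually.of_forall fun N =>
    P.norm_apply_le (norm_trunc_le fun n => (Circle.norm_coe _).le))

/-! ### Polarization and compactness of balls of polynomials -/

section Polarization

variable {m : ℕ} {X : Type*} [NormedAddCommGroup X] [NormedSpace ℂ X]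

/-- Inclusion–exclusion: the complements of the sets `s` in question run over all subsets of the
complement of the range of `r`, and their alternating sum vanishes unless that complement is empty.
-/
theorem sum_neg_one_pow_card_compl {m : ℕ} (r : Fin m → Fin m) :
    ∑ s : Finset (Fin m), (if ∀ j, r j ∈ s then (-1 : ℂ) ^ sᶜ.card else 0) =
      if Function.Surjective r then 1 else 0 := by
  classical
  have h1 : ∑ s : Finset (Fin m), (if ∀ j, r j ∈ s then (-1 : ℂ) ^ sᶜ.card else 0) =
      ∑ t ∈ (Finset.univ.image r)ᶜ.powerset, (-1 : ℂ) ^ t.card := by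
    rw [← Finset.sum_filter]
    refine Finset.sum_nbij' compl compl ?_ ?_ ?_ ?_ ?_
    · intro s hs
      simp only [Finset.mem_filter, Finset.mem_univ, true_and] at hs
      simp only [Finset.mem_powerset]
      refine Finset.compl_subset_compl.2 fun i hi => ?_
      obtain ⟨j, -, rfl⟩ := Finset.mem_image.1 hi
      exact hs j
    · intro t ht
      simp only [Finset.mem_powerset] at ht
      simp only [Finset.mem_filter, Finset.mem_univ, true_and, Finset.mem_compl]
      intro j hj
      exact Finset.mem_compl.1 (ht hj) (Finset.mem_image_of_mem r (Finset.mem_univ j))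
    · simp
    · simp
    · simp
  have h2 := congrArg (Int.cast : ℤ → ℂ)
    (Finset.sum_powerset_neg_one_pow_card (x := (Finset.univ.image r)ᶜ))
  push_cast at h2
  rw [h1, h2]
  refine if_congr ?_ rfl rfl
  rw [Finset.compl_eq_empty_iff, Finset.eq_univ_iff_forall]
  simp [Function.Surjective]

open Classical in
/-- The polarization formula. -/
theorem IsSymm.card_mul_apply {A : Form m X} (hA : IsSymm A) (v : Fin m → X) :
    (Fintype.card {r : Fin m → Fin m // Function.Surjective r} : ℂ) * A v =
      ∑ s : Finset (Fin m), (-1 : ℂ) ^ sᶜ.card * A fun _ => ∑ i ∈ s, v i := by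
  have h : ∀ s : Finset (Fin m), (A fun _ => ∑ i ∈ s, v i) =
      ∑ r : Fin m → Fin m, if ∀ j, r j ∈ s then A fun j => v (r j) else 0 := by
    intro s
    rw [A.map_sum_finset (fun _ i => v i) fun _ => s, ← Finset.sum_filter]
    refine Finset.sum_congr ?_ fun _ _ => rfl
    ext r
    simp
  -- A surjective `r` is a permutation, so by symmetry it contributes `A v`; every other `r`
  -- cancels.
  have h' : ∀ r : Fin m → Fin m, ∑ s : Finset (Fin m),
      (-1 : ℂ) ^ sᶜ.card * (if ∀ j, r j ∈ s then A fun j => v (r j) else 0) =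
      if Function.Surjective r then A v else 0 := by
    intro r
    have h2 : (if Function.Surjective r then A v else 0) =
        (if Function.Surjective r then 1 else 0) * A fun j => v (r j) := by
      split_ifs with hr
      · rw [one_mul]
        exact (hA (Equiv.ofBijective r ⟨Finite.injective_iff_surjective.2 hr, hr⟩) v).symm
      · rw [zero_mul]
    rw [h2, ← sum_neg_one_pow_card_compl, Finset.sum_mul]
    refine Finset.sum_congr rfl fun s _ => ?_
    split_ifs <;> simp
  simp only [h, Finset.mul_sum]
  rw [Finset.sum_comm, Finset.sum_congr rfl fun r _ => h' r, ← Finset.sum_filter,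
    Finset.sum_const, nsmul_eq_mul, Fintype.card_subtype]

theorem HomPoly.norm_apply_le_mul_pow (P : HomPoly m X) {x : X} {R : ℝ} (hR : 0 < R)
    (hx : ‖x‖ ≤ R) : ‖P x‖ ≤ R ^ m * ‖P‖ := by
  have hne : (R : ℂ) ≠ 0 := by exact_mod_cast hR.ne'
  have hn : ‖(R : ℂ)‖ = R := by rw [Complex.norm_real, Real.norm_of_nonneg hR.le]
  have h1 := P.map_smul (R : ℂ) ((R : ℂ)⁻¹ • x)
  rw [smul_inv_smul₀ hne] at h1
  rw [h1, norm_mul, norm_pow, hn]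
  refine mul_le_mul_of_nonneg_left (P.norm_apply_le ?_) (by positivity)
  rw [norm_smul, norm_inv, hn, inv_mul_le_iff₀ hR, mul_one]
  exact hx

/-- There are `2 ^ m` sets in the polarization formula, and each partial sum has norm at most `m`.
The radius `m + 1` stays positive for `m = 0`, and the number of surjections is only bounded below
by `1`. -/
theorem HomPoly.norm_symmForm_apply_le_of_norm_le_one (P : HomPoly m X) {v : Fin m → X}
    (hv : ∀ i, ‖v i‖ ≤ 1) : ‖P.symmForm v‖ ≤ 2 ^ m * (m + 1) ^ m * ‖P‖ := by
  classical
  have hcard : 1 ≤ Fintype.card {r : Fin m → Fin m // Function.Surjective r} :=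
    Fintype.card_pos_iff.2 ⟨⟨id, Function.surjective_id⟩⟩
  have hterm : ∀ s : Finset (Fin m),
      ‖(-1 : ℂ) ^ sᶜ.card * P.symmForm fun _ => ∑ i ∈ s, v i‖ ≤ (m + 1) ^ m * ‖P‖ := by
    intro s
    rw [norm_mul, norm_pow, norm_neg, norm_one, one_pow, one_mul, ← P.symmForm_diag]
    refine P.norm_apply_le_mul_pow (by positivity) ?_
    refine (norm_sum_le_of_le s fun i _ => hv i).trans ?_
    have : (s.card : ℝ) ≤ m := by exact_mod_cast s.card_le_univ.trans_eq (Fintype.card_fin m)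
    simp
    linarith
  have h1 := norm_sum_le_of_le Finset.univ fun s _ => hterm s
  rw [← P.symmForm_isSymm.card_mul_apply v, norm_mul, Complex.norm_natCast, Finset.sum_const,
    Finset.card_univ, Fintype.card_finset, Fintype.card_fin, nsmul_eq_mul] at h1
  push_cast at h1
  calc ‖P.symmForm v‖ ≤ _ * ‖P.symmForm v‖ :=
        le_mul_of_one_le_left (norm_nonneg _) (by exact_mod_cast hcard)
    _ ≤ _ := h1
    _ = _ := by ring

/-- The polarization inequality. -/
theorem HomPoly.norm_symmForm_apply_le (P : HomPoly m X) (v : Fin m → X) :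
    ‖P.symmForm v‖ ≤ 2 ^ m * (m + 1) ^ m * ‖P‖ * ∏ i, ‖v i‖ := by
  by_cases h0 : ∃ i, v i = 0
  · obtain ⟨i, hi⟩ := h0
    rw [P.symmForm.map_coord_zero i hi, norm_zero]
    exact mul_nonneg (by positivity) (Finset.prod_nonneg fun _ _ => norm_nonneg _)
  · push Not at h0
    have hv : v = fun i => (‖v i‖ : ℂ) • (((‖v i‖ : ℂ)⁻¹) • v i) := by
      ext i
      rw [smul_inv_smul₀ (by simpa using h0 i)]
    have h1 := P.symmForm.map_smul_univ (fun i => (‖v i‖ : ℂ)) fun i => ((‖v i‖ : ℂ)⁻¹) • v i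
    rw [← hv] at h1
    rw [h1, norm_smul, norm_prod, mul_comm]
    simp only [Complex.norm_real, norm_norm]
    gcongr
    refine P.norm_symmForm_apply_le_of_norm_le_one fun i => ?_
    rw [norm_smul, norm_inv, Complex.norm_real, norm_norm,
      inv_mul_cancel₀ (norm_ne_zero_iff.2 (h0 i))]

/-- Bounded sequences of polynomials converge pointwise along an ultrafilter. -/
theorem HomPoly.exists_tendsto_hyperfilter {P : ℕ → HomPoly m X} {C : ℝ} (hP : ∀ N, ‖P N‖ ≤ C) :
    ∃ Q : HomPoly m X, ∀ x, Tendsto (fun N => P N x) (hyperfilter ℕ) (𝓝 (Q x)) := by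
  set K : ℝ := 2 ^ m * (m + 1) ^ m * C
  have hbound : ∀ N v, ‖(P N).symmForm v‖ ≤ K * ∏ i, ‖v i‖ := fun N v => by
    refine ((P N).norm_symmForm_apply_le v).trans ?_
    have := Finset.prod_nonneg fun i (_ : i ∈ Finset.univ) => norm_nonneg (v i)
    have : 2 ^ m * (m + 1 : ℝ) ^ m * ‖P N‖ ≤ K := by
      have := hP N
      simp only [K]
      gcongr
    gcongr
  -- The limit is taken on the symmetric forms, so that multilinearity and the bound `K` pass to it.
  have hex : ∀ v, ∃ l, Tendsto (fun N => (P N).symmForm v) (hyperfilter ℕ) (𝓝 l) := by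
    intro v
    obtain ⟨l, -, hl⟩ := (isCompact_closedBall (0 : ℂ) (K * ∏ i, ‖v i‖)).ultrafilter_le_nhds
      ((hyperfilter ℕ).map fun N => (P N).symmForm v) (by
        rw [le_principal_iff]
        exact Filter.mem_map.2 (univ_mem' fun N => by simpa using hbound N v))
    exact ⟨l, hl⟩
  choose L hL using hex
  let A : MultilinearMap ℂ (fun _ : Fin m => X) ℂ :=
    { toFun := L
      map_update_add' := fun v i x y => by
        refine tendsto_nhds_unique (hL _) ?_
        simpa only [ContinuousMultilinearMap.map_update_add] using (hL _).add (hL _)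
      map_update_smul' := fun v i c x => by
        refine tendsto_nhds_unique (hL _) ?_
        simpa only [ContinuousMultilinearMap.map_update_smul] using (hL _).const_smul c }
  refine ⟨⟨fun x => L fun _ => x, A.mkContinuous K fun v =>
    le_of_tendsto (hL v).norm (Eventually.of_forall fun N => hbound N v), fun _ => rfl⟩,
    fun x => ?_⟩
  exact (hL fun _ => x).congr fun N => ((P N).symmForm_diag x).symm

end Polarization

/-! ### Multi-indices -/

/-- The multi-index of the monomial `∏ⱼ w (r j)`. -/
def multiIndex {m : ℕ} (r : Fin m → ℕ) : ℕ →₀ ℤ := ∑ j, Finsupp.single (r j) 1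

variable {m : ℕ}

theorem torusMonomial_multiIndex (r : Fin m → ℕ) (w : Polytorus) :
    torusMonomial (multiIndex r) w = ∏ j, (w (r j) : ℂ) := by
  rw [multiIndex, torusMonomial,
    ← Finsupp.prod_finsetSum_index (fun _ => zpow_zero _)
      fun n _ _ => zpow_add₀ (w n).coe_ne_zero _ _]
  simp

theorem multiIndex_apply (r : Fin m → ℕ) (n : ℕ) :
    multiIndex r n = ∑ j, if r j = n then 1 else 0 := by
  simp [multiIndex, Finsupp.finsetSum_apply, Finsupp.single_apply]

theorem multiIndex_nonneg (r : Fin m → ℕ) : 0 ≤ multiIndex r := fun n => by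
  rw [multiIndex_apply]
  exact Finset.sum_nonneg fun j _ => by split_ifs <;> simp

theorem sum_multiIndex (r : Fin m → ℕ) : ((multiIndex r).sum fun _ k => k) = m := by
  rw [multiIndex, ← Finsupp.sum_finsetSum_index (fun _ => rfl) fun _ _ _ => rfl]
  simp

theorem multiIndex_apply_ne_zero (r : Fin m → ℕ) (j : Fin m) : multiIndex r (r j) ≠ 0 := by
  rw [multiIndex_apply]
  have h : (1 : ℤ) ≤ ∑ i, if r i = r j then 1 else 0 := by
    have := Finset.single_le_sum (f := fun i => if r i = r j then (1 : ℤ) else 0)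
      (fun i _ => by split_ifs <;> simp) (Finset.mem_univ j)
    simpa using this
  omega

theorem exists_eq_of_multiIndex_apply_ne_zero {r : Fin m → ℕ} {n : ℕ} (h : multiIndex r n ≠ 0) :
    ∃ j, r j = n := by
  rw [multiIndex_apply] at h
  obtain ⟨j, -, hj⟩ := Finset.exists_ne_zero_of_sum_ne_zero h
  exact ⟨j, by by_contra h; simp [h] at hj⟩

theorem exists_multiIndex_eq {α : ℕ →₀ ℤ} (h0 : 0 ≤ α) (hsum : (α.sum fun _ k => k) = m) :
    ∃ r : Fin m → ℕ, multiIndex r = α := by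
  induction m generalizing α with
  | zero =>
    refine ⟨Fin.elim0, ?_⟩
    rw [multiIndex, Fin.sum_univ_zero]
    ext n
    by_contra hn
    have := (Finset.sum_eq_zero_iff_of_nonneg fun n _ => h0 n).1 hsum n
      (Finsupp.mem_support_iff.2 (Ne.symm hn))
    exact hn this.symm
  | succ m ih =>
    have hne : α ≠ 0 := by
      rintro rfl
      rw [Finsupp.sum_zero_index] at hsum
      push_cast at hsum
      omega
    obtain ⟨n, hn⟩ := Finsupp.ne_iff.1 hne
    have hn1 : 1 ≤ α n := by
      have : 0 ≤ α n := h0 n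
      have : α n ≠ 0 := hn
      omega
    obtain ⟨r, hr⟩ := ih (α := α - Finsupp.single n 1) (fun k => by
        by_cases hk : k = n
        · subst hk; simpa using hn1
        · simpa [Finsupp.single_apply, Ne.symm hk] using h0 k) (by
        rw [Finsupp.sum_sub_index fun _ _ _ => rfl, hsum]
        simp)
    refine ⟨Fin.cons n r, ?_⟩
    rw [multiIndex, Fin.sum_univ_succ]
    simp only [Fin.cons_zero, Fin.cons_succ]
    rw [← multiIndex, hr]
    abel

/-- The multi-indices of order `m` in the first `N` variables, as maps. -/
abbrev indices (m N : ℕ) : Finset (Fin m → ℕ) := Fintype.piFinset fun _ => Finset.range N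

theorem torusCoeff_sum_mul_torusMonomial {ι : Type*} (s : Finset ι) (a : ι → ℂ)
    (β : ι → ℕ →₀ ℤ) (α : ℕ →₀ ℤ) :
    torusCoeff (fun w => ∑ r ∈ s, a r * torusMonomial (β r) w) α =
      ∑ r ∈ s, if β r = α then a r else 0 := by
  simp only [torusCoeff, Finset.sum_mul, mul_assoc, ← torusMonomial_add]
  rw [integral_finsetSum]
  · refine Finset.sum_congr rfl fun r _ => ?_
    rw [integral_const_mul, integral_torusMonomial, ← sub_eq_add_neg]
    simp [sub_eq_zero]
  · intro r _
    exact (Integrable.of_bound (continuous_torusMonomial _).aestronglyMeasurable 1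
      (ae_of_all _ fun w => (norm_torusMonomial _ w).le)).const_mul _

theorem apply_trunc_coords (P : HomPoly m CZero) (N : ℕ) (w : Polytorus) :
    P (trunc N w.coords) = ∑ r ∈ indices m N,
      P.symmForm (fun j => unitVec (r j)) * torusMonomial (multiIndex r) w := by
  rw [P.symmForm_diag, trunc,
    P.symmForm.map_sum_finset (fun _ n => w.coords n • unitVec n) fun _ => Finset.range N]
  refine Finset.sum_congr rfl fun r _ => ?_
  rw [torusMonomial_multiIndex, mul_comm]
  exact P.symmForm.map_smul_univ _ _

/-! ### Fourier coefficients of the Aron–Berner extension -/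

theorem torusMonomial_tailRot (α : ℕ →₀ ℤ) (N : ℕ) (c : Circle) :
    torusMonomial α (tailRot N c) = (c : ℂ) ^ ∑ n ∈ α.support with N ≤ n, α n := by
  have hc : ∀ s : Finset ℕ, (c : ℂ) ^ ∑ n ∈ s, α n = ∏ n ∈ s, (c : ℂ) ^ α n := fun s => by
    induction s using Finset.induction_on with
    | empty => simp
    | insert n s hn ih => rw [Finset.sum_insert hn, Finset.prod_insert hn,
        zpow_add₀ c.coe_ne_zero, ih]
  rw [hc, Finset.prod_filter, torusMonomial, Finsupp.prod]
  refine Finset.prod_congr rfl fun n _ => ?_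
  by_cases hn : n < N
  · simp [tailRot, hn, not_le.2 hn]
  · simp [tailRot, hn, not_lt.1 hn]

theorem torusMonomial_tailRot_of_support {α : ℕ →₀ ℤ} {N : ℕ} (h : ∀ n ∈ α.support, n < N)
    (c : Circle) : torusMonomial α (tailRot N c) = 1 := by
  rw [torusMonomial_tailRot, Finset.filter_false_of_mem fun n hn => not_le.2 (h n hn)]
  simp

theorem exists_support_lt (α : ℕ →₀ ℤ) : ∃ N, ∀ n ∈ α.support, n < N :=
  ⟨α.support.sup id + 1, fun _ hn => Nat.lt_succ_iff.2 (Finset.le_sup (f := id) hn)⟩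

theorem torusCoeff_sum_comp_tailRot {f : Polytorus → ℂ} (hf : Integrable f polytorusMeasure)
    (m N : ℕ) (α : ℕ →₀ ℤ) :
    torusCoeff (fun w => ∑ j ∈ Finset.range (m + 1), f (tailRot N (circleRoot m ^ j) * w)) α =
      (∑ j ∈ Finset.range (m + 1), torusMonomial α (tailRot N (circleRoot m ^ j))) *
        torusCoeff f α := by
  rw [Finset.sum_mul]
  simp only [← torusCoeff_translate]
  simp only [torusCoeff, Finset.sum_mul]
  rw [integral_finsetSum]
  intro j _
  exact (hf.comp_mul_left _).mul_bdd (c := 1)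
    (continuous_torusMonomial _).aestronglyMeasurable
    (ae_of_all _ fun w => (norm_torusMonomial _ w).le)

/-- The rotations beyond `N` fix the monomial of `α`, so averaging leaves this coefficient
unchanged. -/
theorem torusCoeff_torusExt (P : HomPoly m CZero) {α : ℕ →₀ ℤ} {N : ℕ}
    (h : ∀ n ∈ α.support, n < N) :
    torusCoeff (torusExt P) α = torusCoeff (fun w => P (trunc N w.coords)) α := by
  have h1 := torusCoeff_sum_comp_tailRot ((memLp_torusExt P 1).integrable le_rfl) m N α
  have h2 : torusCoeff (fun w => (m + 1 : ℂ) * P (trunc N w.coords)) α =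
      (m + 1) * torusCoeff (fun w => P (trunc N w.coords)) α := by
    simp only [torusCoeff, mul_assoc, integral_const_mul]
  have hm : (m + 1 : ℂ) ≠ 0 := by exact_mod_cast m.succ_ne_zero
  refine mul_left_cancel₀ hm ?_
  rw [← h2, ← funext (sum_torusExt_tailRot_mul P N), h1,
    Finset.sum_congr rfl fun j _ => torusMonomial_tailRot_of_support h _]
  simp

theorem exists_multiIndex_eq_of_torusCoeff_torusExt_ne_zero {P : HomPoly m CZero} {α : ℕ →₀ ℤ}
    (h : torusCoeff (torusExt P) α ≠ 0) : ∃ r : Fin m → ℕ, multiIndex r = α := by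
  obtain ⟨N, hN⟩ := exists_support_lt α
  rw [torusCoeff_torusExt P hN, funext (apply_trunc_coords P N),
    torusCoeff_sum_mul_torusMonomial] at h
  obtain ⟨r, -, hr⟩ := Finset.exists_ne_zero_of_sum_ne_zero h
  exact ⟨r, by by_contra h; simp [h] at hr⟩

/-! ### Polynomials with prescribed coefficients -/

/-- The coordinate functionals on `c₀`. -/
def coordCLM (n : ℕ) : CZero →L[ℂ] ℂ :=
  LinearMap.mkContinuous
    { toFun := fun x => x n
      map_add' := fun _ _ => rfl
      map_smul' := fun _ _ => rfl } 1 fun x => by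
    rw [one_mul]
    exact (CZero.norm_le (norm_nonneg x)).1 le_rfl n

/-- The polynomial `∑ᵣ a(r) ∏ⱼ x (r j)` in the first `N` coordinates. -/
def polyOfCoeff (a : (Fin m → ℕ) → ℂ) (N : ℕ) : HomPoly m CZero :=
  ⟨fun x => ∑ r ∈ indices m N, a r * ∏ j, x (r j),
    ∑ r ∈ indices m N, a r •
      (ContinuousMultilinearMap.mkPiAlgebra ℂ (Fin m) ℂ).compContinuousLinearMap
        fun j => coordCLM (r j), fun x => by
      simp [coordCLM]⟩

theorem polyOfCoeff_trunc_coords (a : (Fin m → ℕ) → ℂ) (N M : ℕ) (w : Polytorus) :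
    polyOfCoeff a N (trunc M w.coords) =
      ∑ r ∈ indices m (min N M), a r * torusMonomial (multiIndex r) w := by
  change ∑ r ∈ indices m N, a r * ∏ j, trunc M w.coords (r j) = _
  have hsub : indices m (min N M) ⊆ indices m N :=
    Fintype.piFinset_subset _ _ fun _ => Finset.range_subset_range.2 (min_le_left N M)
  rw [← Finset.sum_subset hsub]
  · refine Finset.sum_congr rfl fun r hr => ?_
    rw [torusMonomial_multiIndex]
    congr 1
    refine Finset.prod_congr rfl fun j _ => ?_
    have := Fintype.mem_piFinset.1 hr j
    rw [Finset.mem_range, lt_min_iff] at this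
    rw [trunc_apply, if_pos this.2]
  · intro r hr hr'
    rw [Fintype.mem_piFinset] at hr hr'
    push Not at hr'
    obtain ⟨j, hj⟩ := hr'
    have h1 := Finset.mem_range.1 (hr j)
    rw [Finset.mem_range, lt_min_iff] at hj
    rw [Finset.prod_eq_zero (Finset.mem_univ j), mul_zero]
    rw [trunc_apply, if_neg fun h => hj ⟨h1, h⟩]

/-- The Fourier coefficient of `f` at the multi-index of `r`, equally distributed over the maps
with the same multi-index. -/
def splitCoeff (f : Polytorus → ℂ) (r : Fin m → ℕ) : ℂ :=
  torusCoeff f (multiIndex r) / {r' : Fin m → ℕ | multiIndex r' = multiIndex r}.ncard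

open Classical in
theorem sum_splitCoeff {f : Polytorus → ℂ}
    (hf : ∀ α, torusCoeff f α ≠ 0 → ∃ r : Fin m → ℕ, multiIndex r = α) (N : ℕ) (α : ℕ →₀ ℤ) :
    (∑ r ∈ indices m N, if multiIndex r = α then splitCoeff f r else 0) =
      if ∀ n ∈ α.support, n < N then torusCoeff f α else 0 := by
  split_ifs with h
  · by_cases h0 : torusCoeff f α = 0
    · rw [h0]
      refine Finset.sum_eq_zero fun r _ => ?_
      split_ifs with hr
      · rw [splitCoeff, hr, h0, zero_div]
      · rfl
    · obtain ⟨r₀, hr₀⟩ := hf α h0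
      -- Each such `r` takes its values in the support of `α`, so the whole fibre lies in `indices m
      -- N`; in particular it is finite and `ncard` is its true cardinality.
      have hset : {r : Fin m → ℕ | multiIndex r = α} =
          ((indices m N).filter fun r => multiIndex r = α : Finset (Fin m → ℕ)) := by
        ext r
        simp only [Set.mem_ofPred_eq, Finset.coe_filter, Fintype.mem_piFinset, Finset.mem_range]
        refine ⟨fun hr => ⟨fun j => h _ ?_, hr⟩, fun hr => hr.2⟩
        rw [Finsupp.mem_support_iff, ← hr]
        exact multiIndex_apply_ne_zero r j
      have hcard : (((indices m N).filter fun r => multiIndex r = α).card : ℂ) ≠ 0 := by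
        have : r₀ ∈ (indices m N).filter fun r => multiIndex r = α := by
          rw [← Finset.mem_coe, ← hset]
          exact hr₀
        exact_mod_cast (Finset.card_pos.2 ⟨r₀, this⟩).ne'
      rw [← Finset.sum_filter]
      have hconst : ∀ r ∈ (indices m N).filter fun r => multiIndex r = α, splitCoeff f r =
          torusCoeff f α / ((indices m N).filter fun r => multiIndex r = α).card := by
        intro r hr
        rw [splitCoeff, (Finset.mem_filter.1 hr).2, hset, Set.ncard_coe_finset]
      rw [Finset.sum_congr rfl hconst, Finset.sum_const, nsmul_eq_mul, mul_div_cancel₀ _ hcard]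
  · refine Finset.sum_eq_zero fun r hr => if_neg ?_
    rintro rfl
    refine h fun n hn => ?_
    obtain ⟨j, rfl⟩ := exists_eq_of_multiIndex_apply_ne_zero (Finsupp.mem_support_iff.1 hn)
    exact Finset.mem_range.1 (Fintype.mem_piFinset.1 hr j)

open Classical in
theorem torusCoeff_torusExt_polyOfCoeff {f : Polytorus → ℂ}
    (hf : ∀ α, torusCoeff f α ≠ 0 → ∃ r : Fin m → ℕ, multiIndex r = α) (N : ℕ) (α : ℕ →₀ ℤ) :
    torusCoeff (torusExt (polyOfCoeff (splitCoeff (m := m) f) N)) α =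
      if ∀ n ∈ α.support, n < N then torusCoeff f α else 0 := by
  obtain ⟨M, hM⟩ := exists_support_lt α
  -- The truncation must reach past the support of `α` without cutting the polynomial, which lives
  -- in the first `N` coordinates.
  rw [torusCoeff_torusExt _ (N := max N M) fun n hn => lt_max_of_lt_right (hM n hn),
    funext (polyOfCoeff_trunc_coords _ N (max N M)), torusCoeff_sum_mul_torusMonomial,
    min_eq_left (le_max_left N M), sum_splitCoeff hf]

open Classical in
-- A tail rotation acts by `c ^ k`, where `k` is the total degree of `α` in the variables from `N`
-- on. Since `0 ≤ k ≤ m`, the roots of order `m + 1` detect exactly `k = 0`.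
theorem sum_torusMonomial_tailRot {α : ℕ →₀ ℤ} (h0 : 0 ≤ α)
    (hsum : (α.sum fun _ k => k) = m) (N : ℕ) :
    ∑ j ∈ Finset.range (m + 1), torusMonomial α (tailRot N (circleRoot m ^ j)) =
      if ∀ n ∈ α.support, n < N then (m + 1 : ℂ) else 0 := by
  have hnn : 0 ≤ ∑ n ∈ α.support with N ≤ n, α n := Finset.sum_nonneg fun n _ => h0 n
  obtain ⟨k, hk⟩ : ∃ k : ℕ, ∑ n ∈ α.support with N ≤ n, α n = k := Int.eq_ofNat_of_zero_le hnn
  have hkm : k ≤ m := by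
    have : ∑ n ∈ α.support with N ≤ n, α n ≤ ∑ n ∈ α.support, α n :=
      Finset.sum_le_sum_of_subset_of_nonneg (Finset.filter_subset _ _) fun n _ _ => h0 n
    rw [hk] at this
    have h2 := this.trans_eq hsum
    exact_mod_cast h2
  simp only [torusMonomial_tailRot, hk, Circle.coe_pow, zpow_natCast]
  rw [sum_circleRoot_pow hkm]
  refine if_congr ?_ rfl rfl
  rw [← Int.natCast_eq_zero, ← hk,
    Finset.sum_eq_zero_iff_of_nonneg fun n _ => h0 n]
  constructor
  · intro h n hn
    by_contra hN
    exact Finsupp.mem_support_iff.1 hn (h n (Finset.mem_filter.2 ⟨hn, not_lt.1 hN⟩))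
  · intro h n hn
    have := Finset.mem_filter.1 hn
    exact absurd (h n this.1) (not_lt.2 this.2)

/-- Comparing Fourier coefficients shows that the extension of this polynomial is the average of
tail rotates of `f`, which inherits the bound `C`. -/
theorem norm_polyOfCoeff_splitCoeff_le {f : Polytorus → ℂ} {C : ℝ}
    (hmeas : AEStronglyMeasurable f polytorusMeasure) (hC : ∀ᵐ w ∂polytorusMeasure, ‖f w‖ ≤ C)
    (hf : ∀ α, torusCoeff f α ≠ 0 → ∃ r : Fin m → ℕ, multiIndex r = α) (N : ℕ) :
    ‖polyOfCoeff (splitCoeff (m := m) f) N‖ ≤ C := by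
  classical
  have hfp : ∀ p, MemLp f p polytorusMeasure := fun p => MemLp.of_bound hmeas C hC
  set P := polyOfCoeff (splitCoeff (m := m) f) N with hP
  have hm : (m + 1 : ℂ) ≠ 0 := by exact_mod_cast m.succ_ne_zero
  have hae : (fun w => (m + 1 : ℂ) * torusExt P w) =ᵐ[polytorusMeasure]
      fun w => ∑ j ∈ Finset.range (m + 1), f (tailRot N (circleRoot m ^ j) * w) := by
    refine ae_eq_of_torusCoeff_eq ((memLp_torusExt P 2).const_mul _)
      (memLp_finsetSum _ fun j _ => (hfp 2).comp_measurePreserving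
        (measurePreserving_mul_left polytorusMeasure _)) fun α => ?_
    rw [torusCoeff_sum_comp_tailRot ((hfp 1).integrable le_rfl)]
    have h2 : torusCoeff (fun w => (m + 1 : ℂ) * torusExt P w) α =
        (m + 1) * torusCoeff (torusExt P) α := by
      simp only [torusCoeff, mul_assoc, integral_const_mul]
    rw [h2, hP, torusCoeff_torusExt_polyOfCoeff hf]
    by_cases h0 : torusCoeff f α = 0
    · simp [h0]
    · obtain ⟨r, rfl⟩ := hf α h0
      rw [sum_torusMonomial_tailRot (multiIndex_nonneg r) (sum_multiIndex r)]
      split_ifs <;> simp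
  refine HomPoly.norm_le_of_ae_norm_torusExt_le ?_
  filter_upwards [hae, ae_all_iff.2 fun j : ℕ =>
    ae_comp_mul_left hC (tailRot N (circleRoot m ^ j))] with w hw hwC
  have h1 := norm_sum_le_of_le (Finset.range (m + 1)) fun j _ => hwC j
  rw [← hw, norm_mul, Finset.sum_const, Finset.card_range, nsmul_eq_mul,
    ← Nat.cast_succ, Complex.norm_natCast] at h1
  exact le_of_mul_le_mul_left h1 (by positivity)

/-- Every bounded function on the polytorus with an `m`-homogeneous analytic Fourier series is
the restriction of an Aron–Berner extension. -/
theorem exists_torusExt_ae_eq {f : Polytorus → ℂ} {C : ℝ}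
    (hmeas : AEStronglyMeasurable f polytorusMeasure) (hC : ∀ᵐ w ∂polytorusMeasure, ‖f w‖ ≤ C)
    (hf : ∀ α, torusCoeff f α ≠ 0 → ∃ r : Fin m → ℕ, multiIndex r = α) :
    ∃ P : HomPoly m CZero, torusExt P =ᵐ[polytorusMeasure] f := by
  classical
  obtain ⟨P, hP⟩ := HomPoly.exists_tendsto_hyperfilter (norm_polyOfCoeff_splitCoeff_le hmeas hC hf)
  refine ⟨P, ae_eq_of_torusCoeff_eq (memLp_torusExt P 2) (MemLp.of_bound hmeas C hC) fun α => ?_⟩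
  obtain ⟨N, hN⟩ := exists_support_lt α
  -- At a point truncated at `N`, the approximating polynomials agree for all `M ≥ N`, so the
  -- ultrafilter limit is explicit there.
  have hval : ∀ w : Polytorus, P (trunc N w.coords) =
      ∑ r ∈ indices m N, splitCoeff f r * torusMonomial (multiIndex r) w := by
    intro w
    refine tendsto_nhds_unique (hP (trunc N w.coords)) (tendsto_const_nhds.congr' ?_)
    refine (Eventually.filter_mono Nat.hyperfilter_le_atTop (eventually_ge_atTop N)).mono
      fun M hM => ?_
    have h := polyOfCoeff_trunc_coords (m := m) (splitCoeff f) M N w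
    rw [min_eq_right hM] at h
    exact h.symm
  rw [torusCoeff_torusExt P hN, funext hval, torusCoeff_sum_mul_torusMonomial, sum_splitCoeff hf,
    if_pos hN]

/-! ### The isometry -/

/-- `symmForm` is obtained by choice; its linearity comes from uniqueness, `IsSymm.ext_diag`. -/
theorem HomPoly.symmForm_add {X : Type*} [NormedAddCommGroup X] [NormedSpace ℂ X]
    (P Q : HomPoly m X) : (P + Q).symmForm = P.symmForm + Q.symmForm := by
  refine (P + Q).symmForm_isSymm.ext_diag (fun σ v => ?_) fun x => ?_
  · simp only [_root_.add_apply, P.symmForm_isSymm σ v, Q.symmForm_isSymm σ v]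
  · rw [← HomPoly.symmForm_diag, _root_.add_apply, ← P.symmForm_diag, ← Q.symmForm_diag]
    rfl

theorem HomPoly.symmForm_smul {X : Type*} [NormedAddCommGroup X] [NormedSpace ℂ X]
    (c : ℂ) (P : HomPoly m X) : (c • P).symmForm = c • P.symmForm := by
  refine (c • P).symmForm_isSymm.ext_diag (fun σ v => ?_) fun x => ?_
  · simp only [_root_.smul_apply, P.symmForm_isSymm σ v]
  · rw [← HomPoly.symmForm_diag, _root_.smul_apply, ← P.symmForm_diag]
    rfl

theorem torusExt_add (P Q : HomPoly m CZero) (w : Polytorus) :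
    torusExt (P + Q) w = torusExt P w + torusExt Q w := by
  change arens CZero m (P + Q).symmForm _ = _
  rw [HomPoly.symmForm_add, map_add]
  rfl

theorem torusExt_smul (c : ℂ) (P : HomPoly m CZero) (w : Polytorus) :
    torusExt (c • P) w = c * torusExt P w := by
  change arens CZero m (c • P).symmForm _ = _
  rw [HomPoly.symmForm_smul, _root_.map_smul]
  rfl

theorem toLp_torusExt_mem_hardyHom (P : HomPoly m CZero) :
    (memLp_torusExt P ∞).toLp (torusExt P) ∈ hardyHom ∞ m := by
  have hcoeff := torusCoeff_congr (memLp_torusExt P ∞).coeFn_toLp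
  have hidx : ∀ α, torusCoeff ((memLp_torusExt P ∞).toLp (torusExt P)) α ≠ 0 →
      ∃ r : Fin m → ℕ, multiIndex r = α := fun α h =>
    exists_multiIndex_eq_of_torusCoeff_torusExt_ne_zero (P := P) (by rwa [← hcoeff α])
  refine ⟨fun α hα => ?_, fun α hα => ?_⟩
  · by_contra h
    obtain ⟨r, rfl⟩ := hidx α h
    exact hα (multiIndex_nonneg r)
  · obtain ⟨r, rfl⟩ := hidx α hα
    exact sum_multiIndex r

theorem ae_norm_le_iff_norm_le {f : Lp ℂ ∞ polytorusMeasure} {C : ℝ} (hC : 0 ≤ C) :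
    (∀ᵐ w ∂polytorusMeasure, ‖f w‖ ≤ C) ↔ ‖f‖ ≤ C := by
  rw [Lp.norm_def, eLpNorm_exponent_top]
  constructor
  · intro h
    exact ENNReal.toReal_le_of_le_ofReal hC (eLpNormEssSup_le_of_ae_bound h)
  · intro h
    have hfin : eLpNormEssSup f polytorusMeasure ≠ ∞ := by
      rw [← eLpNorm_exponent_top]
      exact (Lp.memLp f).2.ne
    filter_upwards [enorm_ae_le_eLpNormEssSup f polytorusMeasure] with w hw
    rw [← toReal_enorm]
    exact (ENNReal.toReal_mono hfin hw).trans h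

theorem norm_toLp_torusExt (P : HomPoly m CZero) :
    ‖(memLp_torusExt P ∞).toLp (torusExt P)‖ = ‖P‖ := by
  have hcoe := (memLp_torusExt P ∞).coeFn_toLp
  refine le_antisymm ?_ (HomPoly.norm_le_of_ae_norm_torusExt_le ?_)
  · refine (ae_norm_le_iff_norm_le (norm_nonneg P)).1 ?_
    filter_upwards [hcoe, ae_norm_torusExt_le P] with w h1 h2
    rwa [h1]
  · filter_upwards [hcoe, (ae_norm_le_iff_norm_le (norm_nonneg _)).2 le_rfl] with w h1 h2
    rwa [← h1]

/-- Restriction of the Aron–Berner extension to the polytorus, as a linear isometry. -/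
def torusExtIsometry (m : ℕ) : HomPoly m CZero →ₗᵢ[ℂ] hardyHom ∞ m where
  toFun P := ⟨(memLp_torusExt P ∞).toLp (torusExt P), toLp_torusExt_mem_hardyHom P⟩
  map_add' P Q :=
    Subtype.ext ((MemLp.toLp_congr (memLp_torusExt (P + Q) ∞) ((memLp_torusExt P ∞).add (memLp_torusExt Q ∞))
      (ae_of_all _ (torusExt_add P Q))).trans
        (MemLp.toLp_add (memLp_torusExt P ∞) (memLp_torusExt Q ∞)))
  map_smul' c P :=
    Subtype.ext ((MemLp.toLp_congr (memLp_torusExt (c • P) ∞) ((memLp_torusExt P ∞).const_smul c)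
      (ae_of_all _ (torusExt_smul c P))).trans
        (MemLp.toLp_const_smul c (memLp_torusExt P ∞)))
  norm_map' P := norm_toLp_torusExt P

theorem torusExtIsometry_surjective (m : ℕ) : Function.Surjective (torusExtIsometry m) := by
  intro f
  obtain ⟨P, hP⟩ := exists_torusExt_ae_eq (m := m) (Lp.aestronglyMeasurable f.1)
    ((ae_norm_le_iff_norm_le (norm_nonneg f.1)).2 le_rfl) fun α hα =>
      exists_multiIndex_eq (not_not.1 fun h => hα (f.2.1 α h)) (f.2.2 α hα)
  exact ⟨P, Subtype.ext (Lp.ext ((memLp_torusExt P ∞).coeFn_toLp.trans hP))⟩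

end AronBerner
end

open AronBerner in
theorem proposition4p1 (m : ℕ) :
    ∃ ψ : HomPoly m CZero ≃ₗᵢ[ℂ] hardyHom ∞ m,
      ∀ P : HomPoly m CZero,
        (ψ P : Polytorus → ℂ) =ᵐ[polytorusMeasure]
          fun w => aronBerner P (toBidual w.toLInfty) := by
  exact ⟨LinearIsometryEquiv.ofSurjective (torusExtIsometry m) (torusExtIsometry_surjective m),
    fun P => (memLp_torusExt P ∞).coeFn_toLp⟩
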